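/- Let $N\ge 1$ and $m\ge 1$ be integers and $\alpha\in(0,1)$. For $s\in(0,\frac N2)$ let $$\Phi_s(x)=\kappa_{N,s}|x|^{2s-N},\qquad \kappa_{N,s}=2^{-2s}\pi^{-\frac N2}\frac{\Gamma(\frac{N-2s}2)}{\Gamma(1+s)}\,s,$$ and put $$\kappa_1(s)=2^{-2s}\pi^{-\frac N2}\frac{\Gamma(\frac{N-2s}{2})}{\Gamma(1+s)},\qquad \kappa_2(s)=2^{-2s}\frac{\Gamma(\frac{N-2s}{2})}{\Gamma(\frac N2)\Gamma(1+s)}.$$ For $u:\mathbb R^N\to\mathbb R$ let $\mathcal K_0u=u$ and, for $n\ge1$, $$\mathcal K_nu(x)=\int_{\mathbb R^N}\big(u(x)1_{B_1(x)}(y)-u(y)\big)\,|x-y|^{-N}\big(-2\ln|x-y|\big)^{n-1}\,dy .$$ For $k\ge1$ the $k$-order logarithmic Laplacian is $$\mathcal L_ku(x)=\sum_{j=0}^k\alpha_{k,j}\,\mathcal K_ju(x),\qquad \alpha_{k,0}=(-1)^k\kappa_2^{(k)}(0),\quad \alpha_{k,j}=k(-1)^{k+j}\binom{k-1}{j-1}\kappa_1^{(k-j)}(0)\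 \ (1\le j\le k).$$ Let $C^\alpha_{\rm uloc}(\mathbb R^N)$ be the set of functions $u$ with $\sup_{x}\|u\|_{C^{0,\alpha}(B_1(x))}<\infty$, and $C^{0,\alpha}_c(\mathbb R^N)$ the set of compactly supported $\alpha$-Hölder functions. The Fourier transform $\mathcal F u=\hat u$ is normalized by $\hat u(\zeta)=\int e^{-ix\cdot\zeta}u(x)\,dx$ for $u\in L^1$, and extended to $L^2$ by continuity. (1) Let $u\in C^\alpha_{\rm uloc}(\mathbb R^N)\cap L^\infty(\mathbb R^N)\cap L^1(\mathbb R^N)$. For every $x\in\mathbb R^N$ the integrals defining $\mathcal K_nu(x)$ ($n\ge1$) and $(\Phi_s\ast u)(x)$ ($0<s<\frac N2$) converge absolutely. For every $x$ the function $s\mapsto(\Phi_s\ast u)(x)$, extended to $s=0$ by the value $u(x)$, is $m$ times continuously differentiable on $[0,\epsilon)$ for some $\epsilon>0$ (one-sided derivatives at $0$), and $$\frac{d^m}{ds^m}\Big|_{s=0^+}(\Phi_s\ast u)(x)=(-1)^m\mathcal L_mu(x).$$ (2) For the same $u$, $\mathcal L_mu\in L^2(\mathbb R^N)$ and $$\mathcal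 F(\mathcal L_mu)(\zeta)=(2\ln|\zeta|)^m\,\hat u(\zeta)\qquad\text{for a.e. }\zeta\in\mathbb R^N .$$ (3) Let $u\in C^{0,\alpha}_c(\mathbb R^N)$ and $p\in(1,\infty]$. Then $\mathcal L_mu\in L^p(\mathbb R^N)$, for all sufficiently small $s>0$ the quotient below lies in $L^p(\mathbb R^N)$, and $$\lim_{s\to0^+}\frac{m!}{s^m}\Big(\Phi_s\ast u-u-\sum_{j=1}^{m-1}\frac{(-1)^js^j}{j!}\mathcal L_ju\Big)=(-1)^m\mathcal L_mu\qquad\text{in }L^p(\mathbb R^N).$$ -/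

import Mathlib

open MeasureTheory Set Filter Topology
open scoped NNReal ENNReal FourierTransform

namespace LogLap

/-- `κ₁(s) = 2^{-2s} π^{-N/2} Γ((N-2s)/2) / Γ(1+s)`. -/
noncomputable def kappa1 (N : ℕ) (s : ℝ) : ℝ :=
  (2 : ℝ) ^ (-2 * s) * Real.pi ^ (-(N : ℝ) / 2) * Real.Gamma (((N : ℝ) - 2 * s) / 2)
    / Real.Gamma (1 + s)

/-- `κ₂(s) = 2^{-2s} Γ((N-2s)/2) / (Γ(N/2) Γ(1+s))`. -/
noncomputable def kappa2 (N : ℕ) (s : ℝ) : ℝ :=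
  (2 : ℝ) ^ (-2 * s) * Real.Gamma (((N : ℝ) - 2 * s) / 2)
    / (Real.Gamma ((N : ℝ) / 2) * Real.Gamma (1 + s))

/-- The normalization constant `κ_{N,s} = 2^{-2s} π^{-N/2} Γ((N-2s)/2) / Γ(1+s) · s`. -/
noncomputable def kappaN (N : ℕ) (s : ℝ) : ℝ :=
  (2 : ℝ) ^ (-2 * s) * Real.pi ^ (-(N : ℝ) / 2) * Real.Gamma (((N : ℝ) - 2 * s) / 2)
    / Real.Gamma (1 + s) * s

/-- The normalized Riesz kernel `Φ_s(x) = κ_{N,s} |x|^{2s-N}`. -/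
noncomputable def rieszKernel (N : ℕ) (s : ℝ) (x : EuclideanSpace ℝ (Fin N)) : ℝ :=
  kappaN N s * ‖x‖ ^ (2 * s - (N : ℝ))

/-- The Riesz potential `(Φ_s ∗ u)(x)`. -/
noncomputable def rieszConv (N : ℕ) (s : ℝ) (u : EuclideanSpace ℝ (Fin N) → ℝ) :
    EuclideanSpace ℝ (Fin N) → ℝ :=
  convolution (rieszKernel N s) u (ContinuousLinearMap.mul ℝ ℝ) volume

/-- The family `s ↦ (Φ_s ∗ u)(x)`, extended to `s = 0` by its limit `u(x)` (the kernels `Φ_s`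
tend to the Dirac mass as `s → 0⁺`). -/
noncomputable def rieszFamily (N : ℕ) (u : EuclideanSpace ℝ (Fin N) → ℝ)
    (x : EuclideanSpace ℝ (Fin N)) (s : ℝ) : ℝ :=
  if s = 0 then u x else rieszConv N s u x

/-- `q_n(t) = t^{-N} (-2 ln t)^{n-1}`, used for `n ≥ 1` and `t > 0`. -/
noncomputable def q (N n : ℕ) (t : ℝ) : ℝ :=
  t ^ (-(N : ℝ)) * (-2 * Real.log t) ^ (n - 1)

/-- The integrand `(u(x) 1_{B_1(x)}(y) - u(y)) q_n(|x-y|)` of `K_n u(x)`. -/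
noncomputable def logIntegrand (N n : ℕ) (u : EuclideanSpace ℝ (Fin N) → ℝ)
    (x y : EuclideanSpace ℝ (Fin N)) : ℝ :=
  ((Metric.ball x 1).indicator (fun _ => u x) y - u y) * q N n ‖x - y‖

/-- The zero order operators: `K_0 u = u` and, for `n ≥ 1`,
`K_n u(x) = ∫ (u(x) 1_{B_1(x)}(y) - u(y)) q_n(|x-y|) dy`. -/
noncomputable def logK (N n : ℕ) (u : EuclideanSpace ℝ (Fin N) → ℝ)
    (x : EuclideanSpace ℝ (Fin N)) : ℝ :=
  if n = 0 then u x else ∫ y, logIntegrand N n u x y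

/-- The coefficients `α_0 = (-1)^m κ₂^{(m)}(0)` and, for `1 ≤ j ≤ m`,
`α_j = m (-1)^{m+j} (m-1 choose j-1) κ₁^{(m-j)}(0)`. -/
noncomputable def coeff (N m j : ℕ) : ℝ :=
  if j = 0 then (-1) ^ m * iteratedDeriv m (kappa2 N) 0
  else m * (-1) ^ (m + j) * ((m - 1).choose (j - 1) : ℝ) * iteratedDeriv (m - j) (kappa1 N) 0

/-- The `m`-order logarithmic Laplacian `L_m u = ∑_{j=0}^m α_j K_j u`. -/
noncomputable def logLap (N m : ℕ) (u : EuclideanSpace ℝ (Fin N) → ℝ)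
    (x : EuclideanSpace ℝ (Fin N)) : ℝ :=
  ∑ j ∈ Finset.range (m + 1), coeff N m j * logK N j u x

/-- `C^α_uloc`: the `C^{0,α}`-norms on the unit balls `B_1(x)` are bounded uniformly in `x`. -/
def UlocHolder {N : ℕ} (α : ℝ≥0) (u : EuclideanSpace ℝ (Fin N) → ℝ) : Prop :=
  ∃ C : ℝ≥0, ∀ x, (∀ y ∈ Metric.ball x 1, |u y| ≤ C) ∧ HolderOnWith C α u (Metric.ball x 1)

/-- `C^{0,α}_c`: compactly supported `α`-Hölder functions. -/
def HolderCompact {N : ℕ} (α : ℝ≥0) (u : EuclideanSpace ℝ (Fin N) → ℝ) : Prop :=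
  HasCompactSupport u ∧ ∃ C : ℝ≥0, HolderWith C α u

/-- The Fourier transform `û(ζ) = ∫ e^{-i x·ζ} u(x) dx` of an integrable function. -/
noncomputable def fourierL1 {N : ℕ} (u : EuclideanSpace ℝ (Fin N) → ℂ)
    (ζ : EuclideanSpace ℝ (Fin N)) : ℂ :=
  ∫ x, Complex.exp (-(Complex.I * ((inner ℝ x ζ : ℝ) : ℂ))) * u x

/-- The Fourier transform of a square integrable function, in the same normalization: the
continuous extension to `L²` of `∫ e^{-i x·ζ} f(x) dx`. The library transform `𝓕` extends
`∫ e^{-2πi x·ξ} f(x) dx`, so it is evaluated at `ξ = ζ / (2π)`. -/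
noncomputable def fourierL2 {N : ℕ} {f : EuclideanSpace ℝ (Fin N) → ℂ}
    (hf : MemLp f 2 (volume : Measure (EuclideanSpace ℝ (Fin N))))
    (ζ : EuclideanSpace ℝ (Fin N)) : ℂ :=
  (𝓕 (hf.toLp f) : Lp ℂ 2 (volume : Measure (EuclideanSpace ℝ (Fin N)))) ((2 * Real.pi)⁻¹ • ζ)

/-- The quotient `(m! / s^m) (Φ_s ∗ u - u - ∑_{j=1}^{m-1} ((-1)^j s^j / j!) L_j u)`. -/
noncomputable def taylorQuotient (N m : ℕ) (u : EuclideanSpace ℝ (Fin N) → ℝ) (s : ℝ)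
    (x : EuclideanSpace ℝ (Fin N)) : ℝ :=
  (m.factorial : ℝ) / s ^ m * (rieszConv N s u x - u x
    - ∑ j ∈ Finset.Ico 1 m, (-1) ^ j * s ^ j / (j.factorial : ℝ) * logLap N j u x)

end LogLap

/-! For small `s > 0` add and subtract `u(x)` on the unit ball around `x`. Since `∫_{B_1} |z|^{2s-N}
dz = π^{N/2} / (Γ(N/2) s)`, the factor `s` in `κ_{N,s} = s κ₁(s)` cancels, and `(Φ_s ∗ u)(x) = κ₂(s)
u(x) - s κ₁(s) G(s)`, `G(s) = ∫ (u(x) 1_{B_1(x)}(y) - u(y)) |x-y|^{2s-N} dy`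
(`rieszConv_eq_rieszExt`). The right side is smooth in `s` on both sides of `0`: Hölder continuity
absorbs the singularity on the diagonal, and integrability of `u` controls large `|x-y|`. At `s = 0`
the explicit factor `s` must be differentiated exactly once, so the `m`-th derivative is
`κ₂^{(m)}(0) u(x) - m (κ₁ G)^{(m-1)}(0)`; Leibniz' rule turns this into `(-1)^m L_m u(x)`
(`iteratedDeriv_rieszExt_zero`).

All estimates go through one function `M(x)`, the `majorant`: every `s`-derivative of the extension
is at most `C (|u| + M)`, uniformly in `x` and in `|s| ≤ ε/8`
(`exists_abs_iteratedDeriv_rieszExt_le`). Hence `L_m u` lies in `L^p` as soon as `u` and `M` do, and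
Taylor's formula gives an `L^p` remainder of size `O(s)`. In `L²`, `M` is handled by Cauchy–Schwarz
after splitting near and far from the diagonal (`memLp_two_majorant`); for compact support, `M`
decays like `|x|^{-(N-ε)}`, which is in `L^p` for any `p > 1` when `ε` is small.

For the Fourier symbol, subordination to Gaussians gives `|2πξ|^{-2s}` as the transform of `Φ_s` for
`s > 0`. Tested against a compactly supported `φ`, both sides extend smoothly across `s = 0`, so
their `m`-th derivatives there agree; this is the weak form of the symbol `(2 ln |ζ|)^m`. -/

namespace LogLap

/-! ### Logarithmic kernels and their domination -/

/-- The weight `r^{-N} e^{ε |ln r|}`, which dominates `r^{2s-N} (2 ln r)^i` for small `s`. -/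
noncomputable def logWeight (N : ℕ) (ε r : ℝ) : ℝ :=
  r ^ (-(N : ℝ)) * Real.exp (ε * |Real.log r|)

/-- The `i`-th derivative `r^{2s-N} (2 ln r)^i` of `s ↦ r^{2s-N}`. -/
noncomputable def logPower (N i : ℕ) (s r : ℝ) : ℝ :=
  r ^ (2 * s - (N : ℝ)) * (2 * Real.log r) ^ i

lemma logWeight_nonneg (N : ℕ) (ε : ℝ) {r : ℝ} (hr : 0 ≤ r) : 0 ≤ logWeight N ε r := by
  unfold logWeight; positivity

@[fun_prop]
lemma measurable_logWeight (N : ℕ) (ε : ℝ) : Measurable (logWeight N ε) := by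
  have h := Real.measurable_log
  unfold logWeight
  exact (measurable_id.pow_const _).mul (Real.measurable_exp.comp ((h.abs).const_mul ε))

@[fun_prop]
lemma measurable_logPower (N i : ℕ) (s : ℝ) : Measurable (logPower N i s) := by
  have h := Real.measurable_log
  unfold logPower
  exact (measurable_id.pow_const _).mul ((h.const_mul 2).pow_const i)

/-- Real powers of `0` with nonzero exponent are `0`; this makes the later bounds hold on the
diagonal as well, not only almost everywhere. -/
lemma logWeight_zero {N : ℕ} (hN : 1 ≤ N) (ε : ℝ) : logWeight N ε 0 = 0 := by
  have : (-(N : ℝ)) ≠ 0 := by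
    have : (1 : ℝ) ≤ N := by exact_mod_cast hN
    linarith
  simp [logWeight, Real.zero_rpow this]

lemma logWeight_of_lt_one {N : ℕ} {ε r : ℝ} (hr0 : 0 < r) (hr : r < 1) :
    logWeight N ε r = r ^ (-(N : ℝ) - ε) := by
  have h := Real.log_neg hr0 hr
  rw [logWeight, abs_of_neg h, sub_eq_add_neg, Real.rpow_add hr0, Real.rpow_def_of_pos hr0 (-ε)]
  congr 2
  ring

lemma logWeight_of_one_le {N : ℕ} {ε r : ℝ} (hr : 1 ≤ r) :
    logWeight N ε r = r ^ (-(N : ℝ) + ε) := by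
  have h := Real.log_nonneg hr
  have hr0 : 0 < r := by linarith
  rw [logWeight, abs_of_nonneg h, Real.rpow_add hr0, Real.rpow_def_of_pos hr0 ε, mul_comm ε]

lemma logWeight_le_one {N : ℕ} {ε r : ℝ} (hε : ε ≤ N) (hr : 1 ≤ r) : logWeight N ε r ≤ 1 := by
  rw [logWeight_of_one_le hr]
  exact Real.rpow_le_one_of_one_le_of_nonpos hr (by linarith)

lemma hasDerivAt_logPower (N i : ℕ) (s : ℝ) {r : ℝ} (hr : 0 < r) :
    HasDerivAt (fun t => logPower N i t r) (logPower N (i + 1) s r) s := by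
  have h1 : HasDerivAt (fun t : ℝ => 2 * t - (N : ℝ)) 2 s := by
    simpa using ((hasDerivAt_id s).const_mul 2).sub_const (N : ℝ)
  have h2 := (h1.const_rpow hr).mul_const ((2 * Real.log r) ^ i)
  refine h2.congr_deriv ?_
  simp only [logPower]
  ring

/-- Domination of the differentiated kernels, uniformly for `|s| ≤ ε/4`. -/
lemma abs_logPower_le {N : ℕ} (hN : 1 ≤ N) {ε : ℝ} (hε : 0 < ε) (hε1 : ε ≤ 1) (i : ℕ) {s r : ℝ}
    (hs : |s| ≤ ε / 4) (hr : 0 ≤ r) :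
    |logPower N i s r| ≤ (i.factorial * (4 / ε) ^ i) * logWeight N ε r := by
  have hN' : (1 : ℝ) ≤ N := by exact_mod_cast hN
  have hs' := abs_le.1 hs
  rcases hr.eq_or_lt with rfl | hr
  · have : 2 * s - (N : ℝ) ≠ 0 := by linarith
    simp [logPower, Real.zero_rpow this, logWeight_zero hN]
  · set t := |Real.log r| with ht
    have ht0 : 0 ≤ t := abs_nonneg _
    -- Half of the exponent `ε` pays for the shift `2s`, the other half for the powers of the
    -- logarithm.
    have h1 : r ^ (2 * s) ≤ Real.exp (ε / 2 * t) := by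
      rw [Real.rpow_def_of_pos hr]
      apply Real.exp_le_exp.2
      calc Real.log r * (2 * s) ≤ |Real.log r * (2 * s)| := le_abs_self _
        _ = 2 * |s| * t := by rw [abs_mul, abs_mul]; simp [ht]; ring
        _ ≤ ε / 2 * t := by gcongr; linarith
    -- From `x^i / i! ≤ e^x` at `x = ε t / 2`; the rescaling produces `(4/ε)^i`.
    have h2 : (2 * t) ^ i ≤ i.factorial * (4 / ε) ^ i * Real.exp (ε / 2 * t) := by
      have := Real.pow_div_factorial_le_exp (ε / 2 * t) (by positivity) i
      rw [div_le_iff₀ (by positivity)] at this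
      have e : (2 * t) ^ i = (4 / ε) ^ i * (ε / 2 * t) ^ i := by
        rw [← mul_pow]; congr 1; field_simp; ring
      rw [e]
      calc (4 / ε) ^ i * (ε / 2 * t) ^ i
          ≤ (4 / ε) ^ i * (Real.exp (ε / 2 * t) * i.factorial) := by gcongr
        _ = _ := by ring
    have e : |logPower N i s r| = r ^ (-(N : ℝ)) * (r ^ (2 * s) * (2 * t) ^ i) := by
      rw [logPower, abs_mul, abs_of_nonneg (by positivity), abs_pow, abs_mul, sub_eq_add_neg,
        Real.rpow_add hr]
      simp [ht]; ring
    rw [e, logWeight]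
    calc r ^ (-(N : ℝ)) * (r ^ (2 * s) * (2 * t) ^ i)
        ≤ r ^ (-(N : ℝ)) * (Real.exp (ε / 2 * t) *
            (i.factorial * (4 / ε) ^ i * Real.exp (ε / 2 * t))) := by gcongr
      _ = i.factorial * (4 / ε) ^ i * (r ^ (-(N : ℝ)) *
            (Real.exp (ε / 2 * t) * Real.exp (ε / 2 * t))) := by ring
      _ = _ := by rw [← Real.exp_add]; congr 3; ring

/-! ### The normalization constants -/

/-- The complex Gamma function is holomorphic on the right half-plane, hence analytic there;
smoothness restricts to the real axis. -/
lemma contDiffAt_realGamma {x : ℝ} (hx : 0 < x) {n : WithTop ℕ∞} : ContDiffAt ℝ n Real.Gamma x := by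
  have hopen : IsOpen {z : ℂ | 0 < z.re} := isOpen_lt continuous_const Complex.continuous_re
  have hd : DifferentiableOn ℂ Complex.Gamma {z : ℂ | 0 < z.re} := by
    intro z hz
    refine (Complex.differentiableAt_Gamma z fun m h => ?_).differentiableWithinAt
    have : (0 : ℝ) < z.re := hz
    rw [h] at this
    simp at this
    have h0 : (0 : ℝ) ≤ m := m.cast_nonneg
    linarith
  have ha : AnalyticAt ℂ Complex.Gamma (x : ℂ) :=
    hd.analyticAt (hopen.mem_nhds (by simpa using hx))
  exact ha.contDiffAt.real_of_complex

/-- For `|s| < 1/2 ≤ N/2` both Gamma arguments stay positive. -/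
lemma contDiffOn_kappa1 {N : ℕ} (hN : 1 ≤ N) {n : WithTop ℕ∞} :
    ContDiffOn ℝ n (kappa1 N) (Ioo (-(1 / 2)) (1 / 2)) := by
  have hN' : (1 : ℝ) ≤ N := by exact_mod_cast hN
  intro s hs
  apply ContDiffAt.contDiffWithinAt
  have h1 : ContDiffAt ℝ n (fun s : ℝ => Real.Gamma (((N : ℝ) - 2 * s) / 2)) s :=
    (contDiffAt_realGamma (by linarith [hs.2])).comp s (by fun_prop)
  have h2 : ContDiffAt ℝ n (fun s : ℝ => Real.Gamma (1 + s)) s :=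
    (contDiffAt_realGamma (by linarith [hs.1])).comp s (by fun_prop)
  have h3 : ContDiffAt ℝ n (fun s : ℝ => (2 : ℝ) ^ (-2 * s)) s := by
    simp_rw [Real.rpow_def_of_pos (two_pos : (0 : ℝ) < 2)]
    fun_prop
  unfold kappa1
  exact ((h3.mul contDiffAt_const).mul h1).div h2 (Real.Gamma_pos_of_pos (by linarith [hs.1])).ne'

/-- The ratio is half the area of the unit sphere, i.e. `s` times the integral of `|z|^{2s-N}` over
the unit ball. -/
lemma kappa2_eq (N : ℕ) (s : ℝ) :
    kappa2 N s = Real.pi ^ ((N : ℝ) / 2) / Real.Gamma ((N : ℝ) / 2) * kappa1 N s := by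
  have h0 : Real.pi ^ ((N : ℝ) / 2) * Real.pi ^ (-(N : ℝ) / 2) = 1 := by
    rw [← Real.rpow_add Real.pi_pos, neg_div, add_neg_cancel, Real.rpow_zero]
  rw [kappa2, kappa1, div_mul_div_comm]
  congr 1
  linear_combination -(2 : ℝ) ^ (-2 * s) * Real.Gamma (((N : ℝ) - 2 * s) / 2) * h0

lemma contDiffOn_kappa2 {N : ℕ} (hN : 1 ≤ N) {n : WithTop ℕ∞} :
    ContDiffOn ℝ n (kappa2 N) (Ioo (-(1 / 2)) (1 / 2)) := by
  rw [funext (kappa2_eq N)]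
  exact contDiffOn_const.mul (contDiffOn_kappa1 hN)

lemma kappa2_zero {N : ℕ} (hN : 1 ≤ N) : kappa2 N 0 = 1 := by
  have hN' : (1 : ℝ) ≤ N := by exact_mod_cast hN
  have := (Real.Gamma_pos_of_pos (show 0 < (N : ℝ) / 2 by linarith)).ne'
  simp [kappa2, this]

lemma kappaN_eq (N : ℕ) (s : ℝ) : kappaN N s = s * kappa1 N s := by
  rw [kappaN, kappa1, mul_comm]

/-! ### Integrals of powers of the norm -/

lemma integrableOn_ball_norm_rpow {N : ℕ} (hN : 1 ≤ N) {b : ℝ} (hb : -(N : ℝ) < b) :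
    IntegrableOn (fun z : EuclideanSpace ℝ (Fin N) => ‖z‖ ^ b) (Metric.ball 0 1) := by
  refine integrableOn_ball_of_norm_le_rpow (C := 1) (α := -b) (by simpa using hN) (by simp; linarith)
    (Eventually.of_forall fun z => ?_) (measurable_norm.pow_const _).aestronglyMeasurable
  rw [neg_neg, one_mul, Real.norm_of_nonneg (by positivity)]

/-- Polar coordinates: `N |B_1| ∫_0^1 r^{2s-1} dr = N |B_1| / (2s)`. -/
lemma integral_ball_norm_rpow {N : ℕ} (hN : 1 ≤ N) {s : ℝ} (hs : 0 < s) :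
    ∫ z in Metric.ball (0 : EuclideanSpace ℝ (Fin N)) 1, ‖z‖ ^ (2 * s - (N : ℝ))
      = Real.pi ^ ((N : ℝ) / 2) / Real.Gamma ((N : ℝ) / 2) / s := by
  have hN' : (1 : ℝ) ≤ N := by exact_mod_cast hN
  have : Nonempty (Fin N) := ⟨⟨0, hN⟩⟩
  have h := integral_fun_norm_addHaar (volume : Measure (EuclideanSpace ℝ (Fin N)))
    ((Iio (1 : ℝ)).indicator fun r => r ^ (2 * s - (N : ℝ)))
  rw [← integral_indicator measurableSet_ball]
  have e1 : (fun z : EuclideanSpace ℝ (Fin N) => (Metric.ball 0 1).indicator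
      (fun z => ‖z‖ ^ (2 * s - (N : ℝ))) z) =
      fun z => (Iio (1 : ℝ)).indicator (fun r => r ^ (2 * s - (N : ℝ))) ‖z‖ := by
    ext z
    by_cases hz : ‖z‖ < 1 <;> simp [hz]
  have e2 : ∫ y in Ioi (0 : ℝ), y ^ (N - 1) • (Iio (1 : ℝ)).indicator
      (fun r => r ^ (2 * s - (N : ℝ))) y = 1 / (2 * s) := by
    have : ∀ y ∈ Ioi (0 : ℝ), y ^ (N - 1) • (Iio (1 : ℝ)).indicator
      (fun r => r ^ (2 * s - (N : ℝ))) y = (Iio (1 : ℝ)).indicator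
      (fun r => r ^ (2 * s - 1)) y := by
      intro y hy
      by_cases h : y < 1
      · simp only [mem_Iio, h, indicator_of_mem, smul_eq_mul]
        rw [← Real.rpow_natCast, ← Real.rpow_add hy, Nat.cast_sub hN]
        congr 1; push_cast; ring
      · simp [h]
    rw [setIntegral_congr_fun measurableSet_Ioi this, setIntegral_indicator measurableSet_Iio,
      Ioi_inter_Iio, ← integral_Ioc_eq_integral_Ioo, ← intervalIntegral.integral_of_le zero_le_one,
      integral_rpow (Or.inl (by linarith))]
    simp [hs.ne']
  rw [e1, h]
  simp only [finrank_euclideanSpace, Fintype.card_fin]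
  rw [e2, measureReal_def, EuclideanSpace.volume_ball]
  have hG : Real.Gamma ((N : ℝ) / 2 + 1) = N / 2 * Real.Gamma ((N : ℝ) / 2) :=
    Real.Gamma_add_one (by linarith)
  have hGp := Real.Gamma_pos_of_pos (show 0 < (N : ℝ) / 2 by linarith)
  have hpi : √Real.pi ^ N = Real.pi ^ ((N : ℝ) / 2) := by
    rw [Real.sqrt_eq_rpow, ← Real.rpow_natCast, ← Real.rpow_mul Real.pi_pos.le]; congr 1; ring
  simp only [Fintype.card_fin, ENNReal.ofReal_one, one_pow, one_mul, hG, hpi]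
  rw [ENNReal.toReal_ofReal (by positivity)]
  simp only [smul_eq_mul, nsmul_eq_mul]
  field_simp

lemma integrable_indicator_ball_norm_rpow {N : ℕ} (hN : 1 ≤ N) {b : ℝ} (hb : -(N : ℝ) < b) :
    Integrable ((Metric.ball (0 : EuclideanSpace ℝ (Fin N)) 1).indicator fun z => ‖z‖ ^ b) :=
  (integrable_indicator_iff measurableSet_ball).2 (integrableOn_ball_norm_rpow hN hb)

/-- Outside the ball `(1 + |z|)/2 ≤ |z|`, so the negative power is at most `2^{-b} (1 + |z|)^b`. -/
lemma integrable_indicator_compl_ball_norm_rpow {N : ℕ} {b : ℝ} (hb : b < -(N : ℝ)) :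
    Integrable ((Metric.ball (0 : EuclideanSpace ℝ (Fin N)) 1)ᶜ.indicator fun z => ‖z‖ ^ b) := by
  have hb0 : b < 0 := hb.trans_le (by simp)
  have h := (integrable_one_add_norm (E := EuclideanSpace ℝ (Fin N)) (μ := volume) (r := -b)
    (by simp; linarith)).const_mul (2 ^ (-b))
  refine h.mono' ?_ (Eventually.of_forall fun z => ?_)
  · exact (Measurable.indicator (by fun_prop) measurableSet_ball.compl).aestronglyMeasurable
  · by_cases hz : ‖z‖ < 1
    · simp [hz]; positivity
    · have hz' : 1 ≤ ‖z‖ := not_lt.1 hz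
      simp only [mem_compl_iff, Metric.mem_ball, dist_zero_right, hz, not_false_eq_true,
        indicator_of_mem, neg_neg]
      rw [Real.norm_of_nonneg (by positivity), Real.rpow_neg (by norm_num), ← Real.inv_rpow (by norm_num),
        ← Real.mul_rpow (by norm_num) (by positivity)]
      exact Real.rpow_le_rpow_of_nonpos (by linarith) (by linarith) hb0.le

end LogLap

namespace LogLap

/-! ### Iterated derivatives -/

section Chain

variable {E : Type*} [NormedAddCommGroup E] [NormedSpace ℝ E] {f : ℕ → ℝ → E} {U : Set ℝ}

/-- The derivatives occur as explicit families of integrals, so only single differentiation steps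
have to be justified. -/
lemma iteratedDeriv_of_hasDerivAt_succ (hU : IsOpen U)
    (h : ∀ k, ∀ s ∈ U, HasDerivAt (f k) (f (k + 1) s) s) (k : ℕ) :
    ∀ s ∈ U, iteratedDeriv k (f 0) s = f k s := by
  induction k with
  | zero => intro s _; simp
  | succ k ih =>
    intro s hs
    have : iteratedDeriv k (f 0) =ᶠ[𝓝 s] f k := by
      filter_upwards [hU.mem_nhds hs] with t ht using ih t ht
    rw [iteratedDeriv_succ, this.deriv_eq, (h k s hs).deriv]

lemma contDiffOn_of_hasDerivAt_succ (hU : IsOpen U)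
    (h : ∀ k, ∀ s ∈ U, HasDerivAt (f k) (f (k + 1) s) s) {n : ℕ∞} : ContDiffOn ℝ n (f 0) U := by
  refine contDiffOn_of_differentiableOn_deriv fun k _ => ?_
  have : EqOn (iteratedDerivWithin k (f 0) U) (f k) U := fun s hs => by
    rw [iteratedDerivWithin_of_isOpen hU hs, iteratedDeriv_of_hasDerivAt_succ hU h k s hs]
  exact DifferentiableOn.congr (fun s hs => (h k s hs).differentiableAt.differentiableWithinAt) this

/-- Two smooth families that agree to the right of `0` have the same derivatives at `0`. -/
lemma eq_of_hasDerivAt_succ_of_eqOn {f g : ℕ → ℝ → E} {δ : ℝ} (hδ : 0 < δ)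
    (hf : ∀ k, ∀ s ∈ Ioo (-δ) δ, HasDerivAt (f k) (f (k + 1) s) s)
    (hg : ∀ k, ∀ s ∈ Ioo (-δ) δ, HasDerivAt (g k) (g (k + 1) s) s)
    (h0 : ∀ s ∈ Ioo 0 δ, f 0 s = g 0 s) (k : ℕ) : f k 0 = g k 0 := by
  have hk : ∀ s ∈ Ioo 0 δ, f k s = g k s := by
    induction k with
    | zero => exact h0
    | succ k ih =>
      intro s hs
      have hs' : s ∈ Ioo (-δ) δ := ⟨by linarith [hs.1], hs.2⟩
      have : f k =ᶠ[𝓝 s] g k := by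
        filter_upwards [isOpen_Ioo.mem_nhds hs] with t ht using ih t ht
      exact (hf k s hs').unique ((hg k s hs').congr_of_eventuallyEq this)
  have m0 : (0 : ℝ) ∈ Ioo (-δ) δ := ⟨by linarith, hδ⟩
  -- The `k`-th members agree on `(0, δ)` and are continuous at `0`.
  have h1 : Tendsto (f k) (𝓝[>] 0) (𝓝 (f k 0)) :=
    (hf k 0 m0).continuousAt.tendsto.mono_left nhdsWithin_le_nhds
  have h2 : Tendsto (g k) (𝓝[>] 0) (𝓝 (g k 0)) :=
    (hg k 0 m0).continuousAt.tendsto.mono_left nhdsWithin_le_nhds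
  refine tendsto_nhds_unique h1 (h2.congr' ?_)
  filter_upwards [Ioo_mem_nhdsGT hδ] with s hs using (hk s hs).symm

end Chain

lemma hasDerivAt_iteratedDeriv {f : ℝ → ℝ} {U : Set ℝ} (hU : IsOpen U) (hf : ContDiffOn ℝ (⊤ : ℕ∞) f U)
    (k : ℕ) {s : ℝ} (hs : s ∈ U) :
    HasDerivAt (iteratedDeriv k f) (iteratedDeriv (k + 1) f s) s := by
  have h := hf.differentiableOn_iteratedDerivWithin (m := k) (by exact_mod_cast ENat.natCast_lt_top k)
    hU.uniqueDiffOn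
  have h' : DifferentiableAt ℝ (iteratedDeriv k f) s := by
    refine (h.differentiableAt (hU.mem_nhds hs)).congr_of_eventuallyEq ?_
    filter_upwards [hU.mem_nhds hs] with t ht using (iteratedDerivWithin_of_isOpen hU ht).symm
  rw [iteratedDeriv_succ]
  exact h'.hasDerivAt

lemma exists_abs_iteratedDeriv_le {f : ℝ → ℝ} {U : Set ℝ} (hU : IsOpen U) (hf : ContDiffOn ℝ (⊤ : ℕ∞) f U)
    {K : Set ℝ} (hK : IsCompact K) (hKU : K ⊆ U) (k : ℕ) :
    ∃ C, 0 ≤ C ∧ ∀ s ∈ K, |iteratedDeriv k f s| ≤ C := by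
  have hc : ContinuousOn (iteratedDeriv k f) K := fun s hs =>
    (hasDerivAt_iteratedDeriv hU hf k (hKU hs)).continuousAt.continuousWithinAt
  obtain ⟨C, hC⟩ := hK.exists_bound_of_continuousOn hc
  exact ⟨max C 0, le_max_right _ _, fun s hs => (hC s hs).trans (le_max_left _ _)⟩

/-- In Leibniz' rule only the term with `s` differentiated exactly once survives at `0`. This is the
origin of the factor `k` and of the index shifts in `α_{k,j}`. -/
lemma iteratedDeriv_id_mul_zero {f : ℝ → ℝ} {n : ℕ} (hf : ContDiffAt ℝ (⊤ : ℕ∞) f 0) :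
    iteratedDeriv (n + 1) (fun s => s * f s) 0 = (n + 1) * iteratedDeriv n f 0 := by
  have hf' : ContDiffAt ℝ ((n + 1 : ℕ) : WithTop ℕ∞) f 0 := hf.of_le (by exact_mod_cast le_top)
  have hid : ContDiffAt ℝ ((n + 1 : ℕ) : WithTop ℕ∞) (fun s : ℝ => s) 0 := contDiffAt_id
  rw [iteratedDeriv_fun_mul hid hf', Finset.sum_eq_single 1]
  · simp [iteratedDeriv_one]
  · intro i _ hi
    have : iteratedDeriv i (fun s : ℝ => s) 0 = 0 := by
      rcases i with _ | _ | i
      · simp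
      · simp at hi
      · rw [iteratedDeriv_succ', iteratedDeriv_succ']
        simp
    simp [this]
  · intro h; simp at h

/-! ### The differentiated potentials -/

variable {N : ℕ} {u : EuclideanSpace ℝ (Fin N) → ℝ}

/-- The difference `u(x) 1_{B_1(x)}(y) - u(y)`. -/
noncomputable def cutDiff (u : EuclideanSpace ℝ (Fin N) → ℝ) (x y : EuclideanSpace ℝ (Fin N)) : ℝ :=
  (Metric.ball x 1).indicator (fun _ => u x) y - u y

/-- The potential `∫ (u(x) 1_{B_1(x)}(y) - u(y)) |x-y|^{2s-N} (2 ln |x-y|)^i dy`. -/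
noncomputable def logPotential (i : ℕ) (u : EuclideanSpace ℝ (Fin N) → ℝ) (s : ℝ)
    (x : EuclideanSpace ℝ (Fin N)) : ℝ :=
  ∫ y, cutDiff u x y * logPower N i s ‖x - y‖

/-- The common majorant `∫ |u(x) 1_{B_1(x)}(y) - u(y)| |x-y|^{-N} e^{ε |ln |x-y||} dy` of the
potentials `logPotential i u s` with `|s| ≤ ε/4`. -/
noncomputable def majorant (ε : ℝ) (u : EuclideanSpace ℝ (Fin N) → ℝ)
    (x : EuclideanSpace ℝ (Fin N)) : ℝ :=
  ∫ y, |cutDiff u x y| * logWeight N ε ‖x - y‖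

/-- A continuous function for which the majorant is finite at every point. -/
structure Admissible (ε : ℝ) (u : EuclideanSpace ℝ (Fin N) → ℝ) : Prop where
  pos : 0 < ε
  le_one : ε ≤ 1
  continuous : Continuous u
  integrable : ∀ x, Integrable fun y => |cutDiff u x y| * logWeight N ε ‖x - y‖

lemma measurable_cutDiff (hu : Measurable u) :
    Measurable fun p : EuclideanSpace ℝ (Fin N) × EuclideanSpace ℝ (Fin N) =>
      cutDiff u p.1 p.2 := by
  have hs : MeasurableSet {p : EuclideanSpace ℝ (Fin N) × EuclideanSpace ℝ (Fin N) |
      dist p.2 p.1 < 1} := measurableSet_lt (by fun_prop) (by fun_prop)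
  have : (fun p : EuclideanSpace ℝ (Fin N) × EuclideanSpace ℝ (Fin N) => cutDiff u p.1 p.2) =
      fun p => {p : EuclideanSpace ℝ (Fin N) × EuclideanSpace ℝ (Fin N) |
      dist p.2 p.1 < 1}.indicator (fun p => u p.1) p - u p.2 := by
    ext p
    by_cases h : dist p.2 p.1 < 1 <;> simp [cutDiff, h]
  rw [this]
  exact ((hu.comp measurable_fst).indicator hs).sub (hu.comp measurable_snd)

lemma measurable_logPotential_integrand (hu : Measurable u) (i : ℕ) (s : ℝ) :
    Measurable fun p : EuclideanSpace ℝ (Fin N) × EuclideanSpace ℝ (Fin N) =>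
      cutDiff u p.1 p.2 * logPower N i s ‖p.1 - p.2‖ :=
  (measurable_cutDiff hu).mul ((measurable_logPower N i s).comp (by fun_prop))

lemma measurable_majorant_integrand (hu : Measurable u) (ε : ℝ) :
    Measurable fun p : EuclideanSpace ℝ (Fin N) × EuclideanSpace ℝ (Fin N) =>
      |cutDiff u p.1 p.2| * logWeight N ε ‖p.1 - p.2‖ :=
  (measurable_cutDiff hu).abs.mul ((measurable_logWeight N ε).comp (by fun_prop))

lemma measurable_logPotential (hu : Measurable u) (i : ℕ) (s : ℝ) :
    Measurable (logPotential i u s) :=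
  (measurable_logPotential_integrand hu i s).stronglyMeasurable.integral_prod_right.measurable

lemma measurable_majorant (hu : Measurable u) (ε : ℝ) : Measurable (majorant ε u) :=
  (measurable_majorant_integrand hu ε).stronglyMeasurable.integral_prod_right.measurable

lemma majorant_nonneg (ε : ℝ) (x : EuclideanSpace ℝ (Fin N)) : 0 ≤ majorant ε u x :=
  integral_nonneg fun _ => mul_nonneg (abs_nonneg _) (logWeight_nonneg _ _ (norm_nonneg _))

lemma abs_logPotential_integrand_le (hN : 1 ≤ N) {ε : ℝ} (hu : Admissible ε u) (i : ℕ) {s : ℝ}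
    (hs : |s| ≤ ε / 4) (x y : EuclideanSpace ℝ (Fin N)) :
    ‖cutDiff u x y * logPower N i s ‖x - y‖‖ ≤
      (i.factorial * (4 / ε) ^ i) * (|cutDiff u x y| * logWeight N ε ‖x - y‖) := by
  rw [norm_mul, Real.norm_eq_abs, Real.norm_eq_abs]
  calc _ ≤ |cutDiff u x y| * ((i.factorial * (4 / ε) ^ i) * logWeight N ε ‖x - y‖) := by
        gcongr
        exact abs_logPower_le hN hu.pos hu.le_one i hs (norm_nonneg _)
    _ = _ := by ring

lemma integrable_logPotential (hN : 1 ≤ N) {ε : ℝ} (hu : Admissible ε u) (i : ℕ) {s : ℝ}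
    (hs : |s| ≤ ε / 4) (x : EuclideanSpace ℝ (Fin N)) :
    Integrable fun y => cutDiff u x y * logPower N i s ‖x - y‖ :=
  ((hu.integrable x).const_mul _).mono'
    ((measurable_logPotential_integrand hu.continuous.measurable i s).comp
      measurable_prodMk_left).aestronglyMeasurable
    (Eventually.of_forall (abs_logPotential_integrand_le hN hu i hs x))

lemma abs_logPotential_le (hN : 1 ≤ N) {ε : ℝ} (hu : Admissible ε u) (i : ℕ) {s : ℝ}
    (hs : |s| ≤ ε / 4) (x : EuclideanSpace ℝ (Fin N)) :
    |logPotential i u s x| ≤ (i.factorial * (4 / ε) ^ i) * majorant ε u x := by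
  rw [majorant, ← integral_const_mul]
  exact norm_integral_le_of_norm_le ((hu.integrable x).const_mul _)
    (Eventually.of_forall (abs_logPotential_integrand_le hN hu i hs x))

lemma hasDerivAt_logPotential (hN : 1 ≤ N) {ε : ℝ} (hu : Admissible ε u) (i : ℕ) {s : ℝ}
    (hs : s ∈ Ioo (-(ε / 4)) (ε / 4)) (x : EuclideanSpace ℝ (Fin N)) :
    HasDerivAt (fun t => logPotential i u t x) (logPotential (i + 1) u s x) s := by
  have : Nonempty (Fin N) := ⟨⟨0, hN⟩⟩
  have hm (i : ℕ) (s : ℝ) : AEStronglyMeasurable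
      (fun y => cutDiff u x y * logPower N i s ‖x - y‖) volume :=
    ((measurable_logPotential_integrand hu.continuous.measurable i s).comp
      measurable_prodMk_left).aestronglyMeasurable
  refine (hasDerivAt_integral_of_dominated_loc_of_deriv_le (isOpen_Ioo.mem_nhds hs)
    (Eventually.of_forall (hm i)) (integrable_logPotential hN hu i (abs_le.2 ⟨hs.1.le, hs.2.le⟩) x)
    (hm (i + 1) s) (Eventually.of_forall fun y t ht => abs_logPotential_integrand_le hN hu (i + 1)
      (abs_le.2 ⟨ht.1.le, ht.2.le⟩) x y) ((hu.integrable x).const_mul _) ?_).2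
  -- `s ↦ r^{2s-N}` is differentiated only for `r > 0`; the point `y = x` is null because `N ≥ 1`.
  have h0 : ∀ᵐ y : EuclideanSpace ℝ (Fin N), y ≠ x := by
    simp [ae_iff]
  filter_upwards [h0] with y hy t _
  exact (hasDerivAt_logPower N i t (norm_pos_iff.2 (sub_ne_zero.2 hy.symm))).const_mul _

/-- The smooth extension `κ₂(s) u(x) - s κ₁(s) ∫ (u(x) 1_{B_1(x)}(y) - u(y)) |x-y|^{2s-N} dy` of the
Riesz potential to a neighbourhood of `s = 0`. -/
noncomputable def rieszExt (u : EuclideanSpace ℝ (Fin N) → ℝ) (x : EuclideanSpace ℝ (Fin N))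
    (s : ℝ) : ℝ :=
  kappa2 N s * u x - s * (kappa1 N s * logPotential 0 u s x)

lemma Ioo_quarter_subset {ε : ℝ} (hε : ε ≤ 1) :
    Ioo (-(ε / 4)) (ε / 4) ⊆ Ioo (-(1 / 2) : ℝ) (1 / 2) :=
  Ioo_subset_Ioo (by linarith) (by linarith)

lemma contDiffOn_logPotential (hN : 1 ≤ N) {ε : ℝ} (hu : Admissible ε u)
    (x : EuclideanSpace ℝ (Fin N)) :
    ContDiffOn ℝ (⊤ : ℕ∞) (fun s => logPotential 0 u s x) (Ioo (-(ε / 4)) (ε / 4)) :=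
  contDiffOn_of_hasDerivAt_succ (f := fun i s => logPotential i u s x) isOpen_Ioo
    fun k _ hs => hasDerivAt_logPotential hN hu k hs x

lemma iteratedDeriv_logPotential (hN : 1 ≤ N) {ε : ℝ} (hu : Admissible ε u)
    (x : EuclideanSpace ℝ (Fin N)) (k : ℕ) {s : ℝ} (hs : s ∈ Ioo (-(ε / 4)) (ε / 4)) :
    iteratedDeriv k (fun s => logPotential 0 u s x) s = logPotential k u s x :=
  iteratedDeriv_of_hasDerivAt_succ (f := fun i s => logPotential i u s x) isOpen_Ioo
    (fun k _ hs => hasDerivAt_logPotential hN hu k hs x) k s hs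

lemma contDiffOn_rieszExt (hN : 1 ≤ N) {ε : ℝ} (hu : Admissible ε u)
    (x : EuclideanSpace ℝ (Fin N)) :
    ContDiffOn ℝ (⊤ : ℕ∞) (rieszExt u x) (Ioo (-(ε / 4)) (ε / 4)) :=
  (((contDiffOn_kappa2 hN).mono (Ioo_quarter_subset hu.le_one)).mul contDiffOn_const).sub
    (contDiffOn_id.mul (((contDiffOn_kappa1 hN).mono (Ioo_quarter_subset hu.le_one)).mul
      (contDiffOn_logPotential hN hu x)))

/-- Leibniz' rule for the derivatives of the extended Riesz potential. -/
lemma iteratedDeriv_rieszExt (hN : 1 ≤ N) {ε : ℝ} (hu : Admissible ε u)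
    (x : EuclideanSpace ℝ (Fin N)) (k : ℕ) {s : ℝ} (hs : s ∈ Ioo (-(ε / 4)) (ε / 4)) :
    iteratedDeriv k (rieszExt u x) s = iteratedDeriv k (kappa2 N) s * u x -
      ∑ i ∈ Finset.range (k + 1), k.choose i * iteratedDeriv i (fun s => s * kappa1 N s) s *
        logPotential (k - i) u s x := by
  have hs' := isOpen_Ioo.mem_nhds hs
  have hs2 := isOpen_Ioo.mem_nhds (Ioo_quarter_subset hu.le_one hs)
  have hk2 : ContDiffAt ℝ k (kappa2 N) s := (contDiffOn_kappa2 hN).contDiffAt hs2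
  have hk1 : ContDiffAt ℝ k (fun s => s * kappa1 N s) s :=
    contDiffAt_id.mul ((contDiffOn_kappa1 hN).contDiffAt hs2)
  have hG : ContDiffAt ℝ k (fun s => logPotential 0 u s x) s :=
    ((contDiffOn_logPotential hN hu x).contDiffAt hs').of_le (by exact_mod_cast le_top)
  have e : rieszExt u x = fun s => kappa2 N s * u x - (s * kappa1 N s) * logPotential 0 u s x := by
    ext s; simp only [rieszExt]; ring
  rw [e, iteratedDeriv_fun_sub (hk2.mul contDiffAt_const) (hk1.mul hG),
    iteratedDeriv_mul_const_field, iteratedDeriv_fun_mul hk1 hG]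
  congr 1
  refine Finset.sum_congr rfl fun i _ => ?_
  rw [iteratedDeriv_logPotential hN hu x _ hs]

lemma measurable_iteratedDeriv_rieszExt (hN : 1 ≤ N) {ε : ℝ} (hu : Admissible ε u) (k : ℕ) {s : ℝ}
    (hs : s ∈ Ioo (-(ε / 4)) (ε / 4)) : Measurable fun x => iteratedDeriv k (rieszExt u x) s := by
  simp_rw [fun x => iteratedDeriv_rieszExt hN hu x k hs]
  refine (hu.continuous.measurable.const_mul _).sub (Finset.measurable_sum _ fun i _ => ?_)
  exact (measurable_logPotential hu.continuous.measurable _ _).const_mul _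

/-- The point `x` enters only through `u x` and the potentials, so compactness in `s` makes the
constant independent of `x`. Measurability apart, this is the sole input for `L^p` membership, the
Taylor remainder and differentiation under `∫ dx`. -/
lemma exists_abs_iteratedDeriv_rieszExt_le (hN : 1 ≤ N) {ε : ℝ} (hu : Admissible ε u) (k : ℕ) :
    ∃ C, 0 ≤ C ∧ ∀ s ∈ Icc (-(ε / 8)) (ε / 8), ∀ x,
      |iteratedDeriv k (rieszExt u x) s| ≤ C * (|u x| + majorant ε u x) := by
  have hsub : Icc (-(ε / 8)) (ε / 8) ⊆ Ioo (-(1 / 2) : ℝ) (1 / 2) := fun s hs =>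
    ⟨by linarith [hs.1, hu.le_one, hu.pos], by linarith [hs.2, hu.le_one, hu.pos]⟩
  obtain ⟨A, hA0, hA⟩ := exists_abs_iteratedDeriv_le isOpen_Ioo (contDiffOn_kappa2 hN)
    isCompact_Icc hsub k
  choose B hB0 hB using fun i => exists_abs_iteratedDeriv_le isOpen_Ioo
    (contDiffOn_id.mul (contDiffOn_kappa1 hN)) isCompact_Icc hsub i
  have hε := hu.pos
  refine ⟨A + ∑ i ∈ Finset.range (k + 1), k.choose i * B i *
    ((k - i).factorial * (4 / ε) ^ (k - i)), ?_, fun s hs x => ?_⟩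
  · exact add_nonneg hA0 (Finset.sum_nonneg fun i _ => mul_nonneg
      (mul_nonneg (Nat.cast_nonneg _) (hB0 i)) (by positivity))
  have hs4 : s ∈ Ioo (-(ε / 4)) (ε / 4) := ⟨by linarith [hs.1], by linarith [hs.2]⟩
  have hM := majorant_nonneg (u := u) ε x
  rw [iteratedDeriv_rieszExt hN hu x k hs4, add_mul, Finset.sum_mul]
  refine (abs_sub _ _).trans (add_le_add ?_ ((Finset.abs_sum_le_sum_abs _ _).trans
    (Finset.sum_le_sum fun i _ => ?_)))
  · rw [abs_mul]
    have := hA s hs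
    gcongr
    linarith
  · rw [abs_mul, abs_mul, Nat.abs_cast]
    have h1 := hB i s hs
    have h2 := abs_logPotential_le hN hu (k - i) (abs_le.2 ⟨hs4.1.le, hs4.2.le⟩) x
    have h3 := hB0 i
    rw [mul_assoc (k.choose i * B i : ℝ)]
    refine mul_le_mul (by gcongr; exact h1) (h2.trans ?_) (abs_nonneg _) (by positivity)
    gcongr
    linarith [abs_nonneg (u x)]

/-- Each `s`-derivative produces `+2 ln`, while `q_n` contains `n - 1` factors `-2 ln`; hence the
sign and the shift. -/
lemma logK_eq_logPotential {n : ℕ} (hn : 1 ≤ n) (x : EuclideanSpace ℝ (Fin N)) :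
    logK N n u x = (-1) ^ (n - 1) * logPotential (n - 1) u 0 x := by
  rw [logK, if_neg (by omega), logPotential, ← integral_const_mul]
  congr 1
  ext y
  have : -2 * Real.log ‖x - y‖ = (-1) * (2 * Real.log ‖x - y‖) := by ring
  rw [logIntegrand, q, logPower, cutDiff, this, mul_pow]
  simp only [mul_zero, zero_sub]
  ring

lemma rieszExt_zero (hN : 1 ≤ N) (x : EuclideanSpace ℝ (Fin N)) : rieszExt u x 0 = u x := by
  simp [rieszExt, kappa2_zero hN]

/-- The derivatives of the extended Riesz potential at `s = 0`. -/
lemma iteratedDeriv_rieszExt_zero (hN : 1 ≤ N) {ε : ℝ} (hu : Admissible ε u)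
    (x : EuclideanSpace ℝ (Fin N)) {m : ℕ} (hm : 1 ≤ m) :
    iteratedDeriv m (rieszExt u x) 0 = (-1) ^ m * logLap N m u x := by
  obtain ⟨n, rfl⟩ : ∃ n, m = n + 1 := ⟨m - 1, by omega⟩
  have hε := hu.pos
  have h0 : (0 : ℝ) ∈ Ioo (-(ε / 4)) (ε / 4) := ⟨by linarith, by linarith⟩
  have hs2 := isOpen_Ioo.mem_nhds (Ioo_quarter_subset hu.le_one h0)
  have hk2 : ContDiffAt ℝ (n + 1 : ℕ) (kappa2 N) 0 := (contDiffOn_kappa2 hN).contDiffAt hs2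
  have hk1 : ContDiffAt ℝ (⊤ : ℕ∞) (kappa1 N) 0 := (contDiffOn_kappa1 hN).contDiffAt hs2
  have hG : ContDiffAt ℝ (⊤ : ℕ∞) (fun s => logPotential 0 u s x) 0 :=
    (contDiffOn_logPotential hN hu x).contDiffAt (isOpen_Ioo.mem_nhds h0)
  have hle (k : ℕ) : ((k : ℕ) : WithTop ℕ∞) ≤ (⊤ : ℕ∞) := by exact_mod_cast le_top
  have e : rieszExt u x = fun s => kappa2 N s * u x - s * (kappa1 N s * logPotential 0 u s x) := rfl
  have hid : ContDiffAt ℝ ((n + 1 : ℕ) : WithTop ℕ∞) (fun s : ℝ => s) 0 := contDiffAt_id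
  -- The Leibniz sum is reversed so that its index is the order of the potential, matching
  -- `K_{i+1}`; the `K_0` term of `logLap` is split off to match the `κ₂` term.
  rw [e, iteratedDeriv_fun_sub (hk2.mul contDiffAt_const)
    (hid.mul ((hk1.mul hG).of_le (hle _))), iteratedDeriv_mul_const_field,
    iteratedDeriv_id_mul_zero (hk1.mul hG),
    iteratedDeriv_fun_mul (hk1.of_le (hle n)) (hG.of_le (hle n)),
    ← Finset.sum_range_reflect, logLap, Finset.sum_range_succ' _ (n + 1), mul_add, Finset.mul_sum,
    Finset.mul_sum, sub_eq_neg_add, ← Finset.sum_neg_distrib]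
  have hsq (k : ℕ) : ((-1 : ℝ)) ^ k * (-1) ^ k = 1 := by
    rw [← mul_pow]; simp
  congr 1
  · refine Finset.sum_congr rfl fun i hi => ?_
    have hi' : i ≤ n := by simpa [Nat.lt_succ_iff] using hi
    rw [iteratedDeriv_logPotential hN hu x _ h0, coeff, if_neg (by omega),
      logK_eq_logPotential (by omega)]
    have e2 : n - (n - i) = i := by omega
    have e3 : n + 1 - (i + 1) = n - i := by omega
    simp only [Nat.add_sub_cancel, e2, e3, Nat.choose_symm hi']
    -- The signs of `(-1)^m`, of the coefficient and of `K_{i+1}` multiply to `-1`.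
    have e4 : (-1 : ℝ) ^ (n + 1 + (i + 1)) = (-1) ^ n * (-1) ^ i := by ring
    have hni : ((-1 : ℝ) ^ n * (-1) ^ n) * ((-1) ^ i * (-1) ^ i) = 1 := by rw [hsq, hsq, one_mul]
    rw [e4, pow_succ]
    push_cast
    linear_combination (n + 1) * n.choose i * iteratedDeriv (n - i) (kappa1 N) 0 *
      logPotential i u 0 x * hni
  · simp only [coeff, if_true, logK]
    rw [← mul_assoc, ← mul_assoc, hsq, one_mul]

end LogLap

namespace LogLap

variable {N : ℕ} {u : EuclideanSpace ℝ (Fin N) → ℝ}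

lemma mem_ball_one_iff (x y : EuclideanSpace ℝ (Fin N)) : y ∈ Metric.ball x 1 ↔ ‖x - y‖ < 1 := by
  rw [Metric.mem_ball, dist_comm, dist_eq_norm]

lemma cutDiff_of_lt {x y : EuclideanSpace ℝ (Fin N)} (h : ‖x - y‖ < 1) :
    cutDiff u x y = u x - u y := by
  rw [cutDiff, indicator_of_mem ((mem_ball_one_iff x y).2 h)]

lemma cutDiff_of_le {x y : EuclideanSpace ℝ (Fin N)} (h : 1 ≤ ‖x - y‖) :
    cutDiff u x y = - u y := by
  rw [cutDiff, indicator_of_notMem (by rw [mem_ball_one_iff]; exact h.not_gt), zero_sub]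

/-! ### The Riesz potential of a bounded integrable function -/

lemma integrable_norm_rpow_mul (hN : 1 ≤ N) {C : ℝ} (hb : ∀ x, |u x| ≤ C) (hi : Integrable u)
    {s : ℝ} (hs : s ∈ Ioo (0 : ℝ) (N / 2)) (x : EuclideanSpace ℝ (Fin N)) :
    Integrable fun y => ‖x - y‖ ^ (2 * s - (N : ℝ)) * u y := by
  have h1 := (integrable_indicator_ball_norm_rpow (N := N) hN
    (b := 2 * s - N) (by linarith [hs.1])).comp_sub_left x
  refine ((h1.const_mul C).add hi.norm).mono' ?_ (Eventually.of_forall fun y => ?_)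
  · exact (Measurable.aestronglyMeasurable (Measurable.pow_const (by fun_prop) _)).mul
      hi.aestronglyMeasurable
  · have hC : 0 ≤ C := (abs_nonneg _).trans (hb 0)
    simp only [norm_mul, Pi.add_apply]
    rw [Real.norm_of_nonneg (by positivity), Real.norm_eq_abs]
    by_cases h : ‖x - y‖ < 1
    · rw [indicator_of_mem (by simpa using h)]
      have := hb y
      calc ‖x - y‖ ^ (2 * s - (N : ℝ)) * |u y| ≤ ‖x - y‖ ^ (2 * s - (N : ℝ)) * C := by gcongr
        _ ≤ _ := by linarith [abs_nonneg (u y)]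
    · rw [indicator_of_notMem (by simpa using h), mul_zero, zero_add]
      exact mul_le_of_le_one_left (abs_nonneg _)
        (Real.rpow_le_one_of_one_le_of_nonpos (not_lt.1 h) (by linarith [hs.2]))

lemma convolutionExistsAt_rieszKernel (hN : 1 ≤ N) {C : ℝ} (hb : ∀ x, |u x| ≤ C)
    (hi : Integrable u) {s : ℝ} (hs : s ∈ Ioo (0 : ℝ) (N / 2)) (x : EuclideanSpace ℝ (Fin N)) :
    ConvolutionExistsAt (rieszKernel N s) u x (ContinuousLinearMap.mul ℝ ℝ) volume := by
  have h := ((integrable_norm_rpow_mul hN hb hi hs x).comp_sub_left x).const_mul (kappaN N s)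
  simpa [ConvolutionExistsAt, rieszKernel, mul_assoc] using h

lemma rieszConv_eq (s : ℝ) (x : EuclideanSpace ℝ (Fin N)) :
    rieszConv N s u x = kappaN N s * ∫ y, ‖x - y‖ ^ (2 * s - (N : ℝ)) * u y := by
  rw [rieszConv, convolution_def, ← integral_const_mul, ← integral_sub_left_eq_self _ _ x]
  simp [rieszKernel, mul_assoc]

/-- For `s > 0` the integral of `u(x) |x-y|^{2s-N}` over `B_1(x)` converges by itself, so it can be
split off and evaluated; its `1/s` cancels the `s` in `κ_{N,s}` and leaves `κ₂(s) u(x)`. -/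
lemma rieszConv_eq_rieszExt (hN : 1 ≤ N) {C : ℝ} (hb : ∀ x, |u x| ≤ C)
    (hi : Integrable u) {s : ℝ} (hs : s ∈ Ioo (0 : ℝ) (N / 2)) (x : EuclideanSpace ℝ (Fin N)) :
    rieszConv N s u x = rieszExt u x s := by
  have h1 := (integrable_indicator_ball_norm_rpow (N := N) hN
    (b := 2 * s - N) (by linarith [hs.1])).comp_sub_left x
  have e : logPotential 0 u s x = u x * (Real.pi ^ ((N : ℝ) / 2) / Real.Gamma ((N : ℝ) / 2) / s) -
      ∫ y, ‖x - y‖ ^ (2 * s - (N : ℝ)) * u y := by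
    rw [← integral_ball_norm_rpow hN hs.1, ← integral_indicator measurableSet_ball,
      ← integral_sub_left_eq_self _ _ x, ← integral_const_mul,
      ← integral_sub (h1.const_mul _) (integrable_norm_rpow_mul hN hb hi hs x), logPotential]
    congr 1
    ext y
    simp only [logPower, pow_zero, mul_one]
    by_cases h : ‖x - y‖ < 1
    · rw [cutDiff_of_lt h, indicator_of_mem (by simpa using h)]; ring
    · rw [cutDiff_of_le (not_lt.1 h), indicator_of_notMem (by simpa using h)]; ring
  rw [rieszConv_eq, rieszExt, e, kappaN_eq, kappa2_eq]
  have := hs.1.ne'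
  field_simp
  ring

lemma rieszFamily_eqOn_rieszExt (hN : 1 ≤ N) {C : ℝ} (hb : ∀ x, |u x| ≤ C)
    (hi : Integrable u) (x : EuclideanSpace ℝ (Fin N)) :
    EqOn (rieszFamily N u x) (rieszExt u x) (Ico 0 (N / 2)) := by
  intro s hs
  rcases hs.1.eq_or_lt with rfl | h
  · simp [rieszFamily, rieszExt_zero hN]
  · rw [rieszFamily, if_neg h.ne', rieszConv_eq_rieszExt hN hb hi ⟨h, hs.2⟩]

/-- The right derivatives of the Riesz potentials at `s = 0`. -/
lemma contDiffWithinAt_rieszFamily (hN : 1 ≤ N) {ε : ℝ} (hu : Admissible ε u) {C : ℝ}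
    (hb : ∀ x, |u x| ≤ C) (hi : Integrable u) (x : EuclideanSpace ℝ (Fin N)) {m : ℕ} (hm : 1 ≤ m) :
    ContDiffWithinAt ℝ m (rieszFamily N u x) (Ico (0 : ℝ) ((N : ℝ) / 2)) 0 ∧
      iteratedDerivWithin m (rieszFamily N u x) (Ico (0 : ℝ) ((N : ℝ) / 2)) 0
        = (-1) ^ m * logLap N m u x := by
  have hε := hu.pos
  have hN' : (0 : ℝ) < N / 2 := by positivity
  have h0 : (0 : ℝ) ∈ Ioo (-(ε / 4)) (ε / 4) := ⟨by linarith, by linarith⟩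
  have hc : ContDiffAt ℝ m (rieszExt u x) 0 :=
    ((contDiffOn_rieszExt hN hu x).contDiffAt (isOpen_Ioo.mem_nhds h0)).of_le
      (by exact_mod_cast le_top)
  have heq := rieszFamily_eqOn_rieszExt hN hb hi x
  have hmem : (0 : ℝ) ∈ Ico (0 : ℝ) ((N : ℝ) / 2) := ⟨le_rfl, hN'⟩
  -- The extension is smooth across `0`, so one-sided derivatives of the family are its ordinary
  -- derivatives.
  refine ⟨hc.contDiffWithinAt.congr heq (heq hmem), ?_⟩
  rw [iteratedDerivWithin_congr heq hmem,
    iteratedDerivWithin_eq_iteratedDeriv (uniqueDiffOn_Ico 0 _) hc hmem,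
    iteratedDeriv_rieszExt_zero hN hu x hm]

/-! ### Uniformly locally Hölder continuous functions -/

lemma UlocHolder.exists_bound {α : ℝ≥0} (hu : UlocHolder α u) :
    ∃ C : ℝ, 0 ≤ C ∧ (∀ x, |u x| ≤ C) ∧
      ∀ x y, ‖x - y‖ < 1 → |u x - u y| ≤ C * ‖x - y‖ ^ (α : ℝ) := by
  obtain ⟨C, hC⟩ := hu
  refine ⟨C, C.2, fun x => (hC x).1 x (Metric.mem_ball_self one_pos), fun x y h => ?_⟩
  have := (hC x).2.dist_le (Metric.mem_ball_self one_pos) ((mem_ball_one_iff x y).2 h)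
  rwa [Real.dist_eq, dist_eq_norm] at this

lemma UlocHolder.continuous {α : ℝ≥0} (hα : 0 < α) (hu : UlocHolder α u) : Continuous u := by
  obtain ⟨C, hC⟩ := hu
  refine continuous_iff_continuousAt.2 fun x => ?_
  exact ((hC x).2.continuousOn hα).continuousAt (Metric.ball_mem_nhds x one_pos)

/-- Near the diagonal the Hölder factor `r^α` weakens the weight `r^{-N-ε}` to a power that is
integrable once `ε < α`; away from it the weight is at most `1`. -/
lemma majorant_integrand_le {α ε C : ℝ} (hN : 1 ≤ N) (hε : ε ≤ 1)
    (hC : ∀ x y, ‖x - y‖ < 1 → |u x - u y| ≤ C * ‖x - y‖ ^ α) (x y : EuclideanSpace ℝ (Fin N)) :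
    |cutDiff u x y| * logWeight N ε ‖x - y‖ ≤
      C * (Metric.ball (0 : EuclideanSpace ℝ (Fin N)) 1).indicator
        (fun z => ‖z‖ ^ (α - N - ε)) (x - y) + |u y| := by
  have hN' : (1 : ℝ) ≤ N := by exact_mod_cast hN
  by_cases h : ‖x - y‖ < 1
  · rw [cutDiff_of_lt h, indicator_of_mem (by simpa using h)]
    rcases (norm_nonneg (x - y)).eq_or_lt with h0 | h0
    · rw [← h0, logWeight_zero hN, mul_zero]
      -- Read off from the Hölder bound at a point of norm `1/2` and the origin.
      have hC0 : 0 ≤ C := by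
        have : Nonempty (Fin N) := ⟨⟨0, hN⟩⟩
        obtain ⟨z, hz⟩ := exists_norm_eq (EuclideanSpace ℝ (Fin N)) (c := 1 / 2) (by norm_num)
        have h3 := (abs_nonneg _).trans (hC z 0 (by rw [sub_zero, hz]; norm_num))
        rw [sub_zero, hz] at h3
        exact nonneg_of_mul_nonneg_left h3 (by positivity)
      positivity
    · rw [logWeight_of_lt_one h0 h]
      calc |u x - u y| * ‖x - y‖ ^ (-(N : ℝ) - ε)
          ≤ C * ‖x - y‖ ^ α * ‖x - y‖ ^ (-(N : ℝ) - ε) := by gcongr; exact hC x y h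
        _ = C * ‖x - y‖ ^ (α - N - ε) := by rw [mul_assoc, ← Real.rpow_add h0]; ring_nf
        _ ≤ _ := le_add_of_nonneg_right (abs_nonneg _)
  · rw [cutDiff_of_le (not_lt.1 h), indicator_of_notMem (by simpa using h), mul_zero, zero_add,
      abs_neg]
    exact mul_le_of_le_one_right (abs_nonneg _) (logWeight_le_one (by linarith) (not_lt.1 h))

lemma admissible_of_holder {α ε C : ℝ} (hN : 1 ≤ N) (hε0 : 0 < ε) (hε : ε ≤ 1) (hεα : ε < α)
    (hc : Continuous u) (hC : ∀ x y, ‖x - y‖ < 1 → |u x - u y| ≤ C * ‖x - y‖ ^ α)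
    (hi : Integrable u) : Admissible ε u where
  pos := hε0
  le_one := hε
  continuous := hc
  integrable x := by
    have h1 := (integrable_indicator_ball_norm_rpow (N := N) hN
      (b := α - N - ε) (by linarith)).comp_sub_left x
    refine ((h1.const_mul C).add hi.abs).mono' ?_ (Eventually.of_forall fun y => ?_)
    · exact ((measurable_majorant_integrand hc.measurable ε).comp
        measurable_prodMk_left).aestronglyMeasurable
    · rw [Real.norm_of_nonneg (mul_nonneg (abs_nonneg _) (logWeight_nonneg _ _ (norm_nonneg _)))]
      exact majorant_integrand_le hN hε hC x y

/-- Translation invariance removes `x` from the integrated pointwise bound. -/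
lemma exists_majorant_le {α ε C : ℝ} (hN : 1 ≤ N) (hε0 : 0 < ε) (hε : ε ≤ 1) (hεα : ε < α)
    (hc : Continuous u) (hC : ∀ x y, ‖x - y‖ < 1 → |u x - u y| ≤ C * ‖x - y‖ ^ α)
    (hi : Integrable u) : ∃ B, 0 ≤ B ∧ ∀ x, majorant ε u x ≤ B := by
  have h0 := integrable_indicator_ball_norm_rpow (N := N) hN (b := α - N - ε) (by linarith)
  have key (x) : majorant ε u x ≤ C * (∫ z, (Metric.ball (0 : EuclideanSpace ℝ (Fin N)) 1).indicator
        (fun z => ‖z‖ ^ (α - N - ε)) z) + ∫ y, |u y| := by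
    have h1 := h0.comp_sub_left x
    rw [← integral_sub_left_eq_self _ _ x, ← integral_const_mul,
      ← integral_add (h1.const_mul C) hi.abs]
    exact integral_mono ((admissible_of_holder hN hε0 hε hεα hc hC hi).integrable x)
      ((h1.const_mul C).add hi.abs) (majorant_integrand_le hN hε hC x)
  exact ⟨_, (majorant_nonneg ε 0).trans (key 0), key⟩

lemma integrable_logIntegrand (hN : 1 ≤ N) {ε : ℝ} (hu : Admissible ε u) {j : ℕ}
    (x : EuclideanSpace ℝ (Fin N)) : Integrable (logIntegrand N j u x) := by
  have hε := hu.pos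
  refine ((integrable_logPotential hN hu (j - 1) (s := 0) (by simp; linarith) x).const_mul
    ((-1) ^ (j - 1))).congr (Eventually.of_forall fun y => ?_)
  have : -2 * Real.log ‖x - y‖ = (-1) * (2 * Real.log ‖x - y‖) := by ring
  simp only [logIntegrand, q, logPower, cutDiff, this, mul_pow, mul_zero, zero_sub]
  ring

end LogLap

namespace LogLap

/-! ### Square integrability of the majorant -/

lemma lintegral_sq_le {Z : Type*} [MeasurableSpace Z] (ν : Measure Z) {g : Z → ℝ≥0∞}
    (hg : Measurable g) : (∫⁻ z, g z ∂ν) ^ 2 ≤ ν univ * ∫⁻ z, g z ^ 2 ∂ν := by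
  have h := ENNReal.lintegral_mul_le_Lp_mul_Lq ν Real.HolderConjugate.two_two
    (f := fun _ => 1) (g := g) measurable_const.aemeasurable hg.aemeasurable
  have h2 : (∫⁻ z, g z ∂ν) ≤ (ν univ) ^ (1 / 2 : ℝ) * (∫⁻ z, g z ^ 2 ∂ν) ^ (1 / 2 : ℝ) := by
    simpa using h
  calc (∫⁻ z, g z ∂ν) ^ 2 ≤ ((ν univ) ^ (1 / 2 : ℝ) * (∫⁻ z, g z ^ 2 ∂ν) ^ (1 / 2 : ℝ)) ^ 2 := by
        gcongr
    _ = _ := by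
      rw [← ENNReal.mul_rpow_of_nonneg _ _ (by norm_num), ← ENNReal.rpow_natCast,
        ← ENNReal.rpow_mul]
      norm_num

/-- Cauchy–Schwarz against the constant `1` in `z`, then Tonelli. Useful when `ν` is finite. -/
lemma lintegral_lintegral_sq_le {X Z : Type*} [MeasurableSpace X] [MeasurableSpace Z]
    (μ : Measure X) [SFinite μ] (ν : Measure Z) [SFinite ν] {g : X → Z → ℝ≥0∞}
    (hg : Measurable (Function.uncurry g)) :
    ∫⁻ x, (∫⁻ z, g x z ∂ν) ^ 2 ∂μ ≤ ν univ * ∫⁻ z, ∫⁻ x, g x z ^ 2 ∂μ ∂ν := by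
  calc ∫⁻ x, (∫⁻ z, g x z ∂ν) ^ 2 ∂μ ≤ ∫⁻ x, ν univ * ∫⁻ z, g x z ^ 2 ∂ν ∂μ :=
        lintegral_mono fun x => lintegral_sq_le ν hg.of_uncurry_left
    _ = ν univ * ∫⁻ x, ∫⁻ z, g x z ^ 2 ∂ν ∂μ :=
        lintegral_const_mul _ (hg.pow_const 2).lintegral_prod_right'
    _ = _ := by rw [lintegral_lintegral_swap (hg.pow_const 2).aemeasurable]

lemma ennreal_add_sq_le (a b : ℝ≥0∞) : (a + b) ^ 2 ≤ 4 * (a ^ 2 + b ^ 2) := by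
  have key (c : ℝ≥0∞) : (c + c) ^ 2 = 4 * c ^ 2 := by ring
  rcases le_total a b with h | h
  · calc (a + b) ^ 2 ≤ (b + b) ^ 2 := by gcongr
      _ = 4 * b ^ 2 := key b
      _ ≤ _ := by gcongr; exact le_add_self
  · calc (a + b) ^ 2 ≤ (a + a) ^ 2 := by gcongr
      _ = 4 * a ^ 2 := key a
      _ ≤ _ := by gcongr; exact le_self_add

variable {N : ℕ} {u : EuclideanSpace ℝ (Fin N) → ℝ}

/-- The part of the majorant near the diagonal is square integrable. -/
lemma lintegral_near_sq_lt_top (hc : Measurable u) (hi : Integrable u)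
    {k : EuclideanSpace ℝ (Fin N) → ℝ} (hk : Integrable k) (hkm : Measurable k) :
    ∫⁻ x, (∫⁻ y, ENNReal.ofReal (k (x - y)) * ENNReal.ofReal (√|u x - u y|)) ^ 2 < ∞ := by
  set ν := (volume : Measure (EuclideanSpace ℝ (Fin N))).withDensity fun z => ENNReal.ofReal (k z)
  have hν : ν univ < ∞ := by
    simp only [ν, withDensity_apply _ MeasurableSet.univ, Measure.restrict_univ]
    exact hk.lintegral_lt_top
  have : IsFiniteMeasure ν := ⟨hν⟩
  have e (x) : ∫⁻ y, ENNReal.ofReal (k (x - y)) * ENNReal.ofReal (√|u x - u y|) =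
      ∫⁻ z, ENNReal.ofReal (√|u x - u (x - z)|) ∂ν := by
    have hm : Measurable fun z => ENNReal.ofReal (√|u x - u (x - z)|) :=
      (measurable_const.sub (hc.comp (measurable_const.sub measurable_id))).abs.sqrt.ennreal_ofReal
    rw [lintegral_withDensity_eq_lintegral_mul _ hkm.ennreal_ofReal hm,
      ← lintegral_sub_left_eq_self _ x]
    simp
  simp_rw [e]
  have hg : Measurable (Function.uncurry fun x z : EuclideanSpace ℝ (Fin N) =>
      ENNReal.ofReal (√|u x - u (x - z)|)) :=
    ((hc.comp measurable_fst).sub (hc.comp (measurable_fst.sub measurable_snd))).abs.sqrt.ennreal_ofReal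
  refine (lintegral_lintegral_sq_le _ ν hg).trans_lt (ENNReal.mul_lt_top hν ?_)
  -- Squaring removes the root, and `∫ |u(x) - u(x-z)| dx ≤ 2 ‖u‖₁` uniformly in `z`.
  have h2 (z) : ∫⁻ x, ENNReal.ofReal (√|u x - u (x - z)|) ^ 2 ≤ 2 * ∫⁻ x, ‖u x‖ₑ := by
    calc ∫⁻ x, ENNReal.ofReal (√|u x - u (x - z)|) ^ 2 ≤ ∫⁻ x, (‖u x‖ₑ + ‖u (x - z)‖ₑ) := by
          refine lintegral_mono fun x => ?_
          rw [← ENNReal.ofReal_pow (Real.sqrt_nonneg _), Real.sq_sqrt (abs_nonneg _),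
            ← Real.norm_eq_abs, ofReal_norm]
          exact enorm_sub_le
      _ = 2 * ∫⁻ x, ‖u x‖ₑ := by
          rw [lintegral_add_left hc.enorm, lintegral_sub_right_eq_self (fun x => ‖u x‖ₑ) z, two_mul]
  refine (lintegral_mono h2).trans_lt ?_
  rw [lintegral_const]
  exact ENNReal.mul_lt_top (ENNReal.mul_lt_top (by simp) hi.2) hν

/-- The part of the majorant away from the diagonal is square integrable. -/
lemma lintegral_far_sq_lt_top (hc : Measurable u) (hi : Integrable u)
    {k : EuclideanSpace ℝ (Fin N) → ℝ} (hk : Integrable fun z => k z ^ 2) (hk0 : ∀ z, 0 ≤ k z)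
    (hkm : Measurable k) :
    ∫⁻ x, (∫⁻ y, ENNReal.ofReal |u y| * ENNReal.ofReal (k (x - y))) ^ 2 < ∞ := by
  -- The roles are exchanged here: `|u| dy` is the finite measure, and the kernel only has to be
  -- square integrable.
  set ν := (volume : Measure (EuclideanSpace ℝ (Fin N))).withDensity fun z => ENNReal.ofReal |u z|
  have hν : ν univ < ∞ := by
    simp only [ν, withDensity_apply _ MeasurableSet.univ, Measure.restrict_univ]
    exact hi.abs.lintegral_lt_top
  have : IsFiniteMeasure ν := ⟨hν⟩
  have e (x) : ∫⁻ y, ENNReal.ofReal |u y| * ENNReal.ofReal (k (x - y)) =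
      ∫⁻ y, ENNReal.ofReal (k (x - y)) ∂ν := by
    have hm : Measurable fun y => ENNReal.ofReal (k (x - y)) :=
      (hkm.comp (measurable_const.sub measurable_id)).ennreal_ofReal
    rw [lintegral_withDensity_eq_lintegral_mul _ hc.abs.ennreal_ofReal hm]
    rfl
  simp_rw [e]
  have hg : Measurable (Function.uncurry fun x z : EuclideanSpace ℝ (Fin N) =>
      ENNReal.ofReal (k (x - z))) := (hkm.comp (measurable_fst.sub measurable_snd)).ennreal_ofReal
  refine (lintegral_lintegral_sq_le _ ν hg).trans_lt (ENNReal.mul_lt_top hν ?_)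
  have h2 (z) : ∫⁻ x, ENNReal.ofReal (k (x - z)) ^ 2 = ∫⁻ x, ENNReal.ofReal (k x ^ 2) := by
    rw [lintegral_sub_right_eq_self (fun x => ENNReal.ofReal (k x) ^ 2) z]
    simp_rw [ENNReal.ofReal_pow (hk0 _)]
  simp_rw [h2]
  rw [lintegral_const]
  exact ENNReal.mul_lt_top hk.lintegral_lt_top hν

/-- Half of the Hölder gain tames the singularity; the remaining `√|u x - u y|` has an integrable
square, which retains decay in `x` that the full Hölder bound would discard. -/
lemma majorant_integrand_le_sqrt {α ε C : ℝ} (hN : 1 ≤ N) (hC0 : 0 ≤ C)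
    (hC : ∀ x y, ‖x - y‖ < 1 → |u x - u y| ≤ C * ‖x - y‖ ^ α) (x y : EuclideanSpace ℝ (Fin N)) :
    |cutDiff u x y| * logWeight N ε ‖x - y‖ ≤
      √C * ((Metric.ball (0 : EuclideanSpace ℝ (Fin N)) 1).indicator
        (fun z => ‖z‖ ^ (α / 2 - N - ε)) (x - y) * √|u x - u y|) +
      |u y| * (Metric.ball (0 : EuclideanSpace ℝ (Fin N)) 1)ᶜ.indicator
        (fun z => ‖z‖ ^ (-(N : ℝ) + ε)) (x - y) := by
  by_cases h : ‖x - y‖ < 1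
  · rw [cutDiff_of_lt h, indicator_of_mem (by simpa using h),
      indicator_of_notMem (by simpa using h), mul_zero, add_zero]
    rcases (norm_nonneg (x - y)).eq_or_lt with h0 | h0
    · rw [← h0, logWeight_zero hN, mul_zero]
      positivity
    · rw [logWeight_of_lt_one h0 h]
      have h1 : √|u x - u y| ≤ √C * ‖x - y‖ ^ (α / 2) := by
        rw [Real.sqrt_le_left (by positivity), mul_pow, Real.sq_sqrt hC0, ← Real.rpow_mul_natCast
          h0.le]
        simpa using hC x y h
      calc |u x - u y| * ‖x - y‖ ^ (-(N : ℝ) - ε)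
          = √|u x - u y| * √|u x - u y| * ‖x - y‖ ^ (-(N : ℝ) - ε) := by
            rw [Real.mul_self_sqrt (abs_nonneg _)]
        _ ≤ √|u x - u y| * (√C * ‖x - y‖ ^ (α / 2)) * ‖x - y‖ ^ (-(N : ℝ) - ε) := by gcongr
        _ = √C * (‖x - y‖ ^ (α / 2) * ‖x - y‖ ^ (-(N : ℝ) - ε) * √|u x - u y|) := by ring
        _ = _ := by rw [← Real.rpow_add h0]; ring_nf
  · rw [cutDiff_of_le (not_lt.1 h), indicator_of_notMem (by simpa using h), zero_mul, mul_zero,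
      zero_add, abs_neg, indicator_of_mem (by simpa using h), logWeight_of_one_le (not_lt.1 h)]

/-- `ε < α/2` makes the near kernel integrable, and `ε < 1/2 ≤ N/2` makes the far kernel square
integrable. -/
lemma memLp_two_majorant {α ε C : ℝ} (hN : 1 ≤ N) (hu : Admissible ε u) (hεα : ε < α / 2)
    (hε2 : ε < 1 / 2) (hC0 : 0 ≤ C)
    (hC : ∀ x y, ‖x - y‖ < 1 → |u x - u y| ≤ C * ‖x - y‖ ^ α) (hi : Integrable u) :
    MemLp (majorant ε u) 2 := by
  have hN' : (1 : ℝ) ≤ N := by exact_mod_cast hN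
  have hm := hu.continuous.measurable
  rw [memLp_two_iff_integrable_sq (measurable_majorant hm ε).aestronglyMeasurable]
  refine ⟨((measurable_majorant hm ε).pow_const 2).aestronglyMeasurable, ?_⟩
  set k₁ : EuclideanSpace ℝ (Fin N) → ℝ := (Metric.ball (0 : EuclideanSpace ℝ (Fin N)) 1).indicator
    (fun z => ‖z‖ ^ (α / 2 - N - ε)) with hk₁
  set k₂ : EuclideanSpace ℝ (Fin N) → ℝ := (Metric.ball (0 : EuclideanSpace ℝ (Fin N)) 1)ᶜ.indicator
    (fun z => ‖z‖ ^ (-(N : ℝ) + ε)) with hk₂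
  have hk₁m : Measurable k₁ := (measurable_norm.pow_const _).indicator measurableSet_ball
  have hk₂m : Measurable k₂ := (measurable_norm.pow_const _).indicator measurableSet_ball.compl
  have hk₁0 (z) : 0 ≤ k₁ z := indicator_nonneg (fun z _ => by positivity) z
  have hk₂0 (z) : 0 ≤ k₂ z := indicator_nonneg (fun z _ => by positivity) z
  have hk₁i : Integrable k₁ := integrable_indicator_ball_norm_rpow hN (by linarith)
  have hk₂i : Integrable fun z => k₂ z ^ 2 := by
    refine (integrable_indicator_compl_ball_norm_rpow (N := N) (b := 2 * (-(N : ℝ) + ε))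
      (by linarith)).congr (Eventually.of_forall fun z => ?_)
    by_cases h : ‖z‖ < 1
    · simp [hk₂, h]
    · simp only [hk₂, mem_compl_iff, Metric.mem_ball, dist_zero_right, h, not_false_eq_true,
        indicator_of_mem]
      rw [← Real.rpow_mul_natCast (norm_nonneg z)]
      congr 1; push_cast; ring
  have hA := lintegral_near_sq_lt_top hm hi hk₁i hk₁m
  have hB := lintegral_far_sq_lt_top hm hi hk₂i hk₂0 hk₂m
  have hAm (x) : Measurable fun y => ENNReal.ofReal (k₁ (x - y)) * ENNReal.ofReal (√|u x - u y|) :=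
    (hk₁m.comp (measurable_const.sub measurable_id)).ennreal_ofReal.mul
      (measurable_const.sub hm).abs.sqrt.ennreal_ofReal
  have hAm' : Measurable fun x => (∫⁻ y, ENNReal.ofReal (k₁ (x - y)) *
      ENNReal.ofReal (√|u x - u y|)) ^ 2 := by
    refine Measurable.pow_const (Measurable.lintegral_prod_right' (f := fun p =>
      ENNReal.ofReal (k₁ (p.1 - p.2)) * ENNReal.ofReal (√|u p.1 - u p.2|)) ?_) 2
    exact (hk₁m.comp (measurable_fst.sub measurable_snd)).ennreal_ofReal.mul
      ((hm.comp measurable_fst).sub (hm.comp measurable_snd)).abs.sqrt.ennreal_ofReal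
  have hle (x) : ‖majorant ε u x ^ 2‖ₑ ≤ 4 * (ENNReal.ofReal √C ^ 2 *
      (∫⁻ y, ENNReal.ofReal (k₁ (x - y)) * ENNReal.ofReal (√|u x - u y|)) ^ 2 +
      (∫⁻ y, ENNReal.ofReal |u y| * ENNReal.ofReal (k₂ (x - y))) ^ 2) := by
    rw [enorm_pow, ← mul_pow]
    refine le_trans ?_ (ennreal_add_sq_le _ _)
    gcongr
    rw [Real.enorm_of_nonneg (majorant_nonneg ε x), majorant,
      ofReal_integral_eq_lintegral_ofReal (hu.integrable x) (Eventually.of_forall fun y =>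
        mul_nonneg (abs_nonneg _) (logWeight_nonneg _ _ (norm_nonneg _))),
      ← lintegral_const_mul _ (hAm x), ← lintegral_add_left ((hAm x).const_mul _)]
    refine lintegral_mono fun y => ?_
    rw [← ENNReal.ofReal_mul (hk₁0 _), ← ENNReal.ofReal_mul (Real.sqrt_nonneg _),
      ← ENNReal.ofReal_mul (abs_nonneg _), ← ENNReal.ofReal_add
        (mul_nonneg (Real.sqrt_nonneg _) (mul_nonneg (hk₁0 _) (Real.sqrt_nonneg _)))
        (mul_nonneg (abs_nonneg _) (hk₂0 _))]
    exact ENNReal.ofReal_le_ofReal (majorant_integrand_le_sqrt hN hC0 hC x y)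
  refine (lintegral_mono hle).trans_lt ?_
  rw [lintegral_const_mul' _ _ (by simp), lintegral_add_left (hAm'.const_mul _),
    lintegral_const_mul _ hAm']
  exact ENNReal.mul_lt_top (by simp) (ENNReal.add_lt_top.2 ⟨ENNReal.mul_lt_top (by simp) hA, hB⟩)

/-! ### Decay of the majorant for compactly supported functions -/

lemma exists_majorant_le_of_hasCompactSupport {ε B : ℝ} (hN : 1 ≤ N) (hu : Admissible ε u)
    (hs : HasCompactSupport u) (hB : ∀ x, majorant ε u x ≤ B) :
    ∃ C, 0 ≤ C ∧ ∀ x, majorant ε u x ≤ C * (1 + ‖x‖) ^ (-((N : ℝ) - ε)) := by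
  have hN' : (1 : ℝ) ≤ N := by exact_mod_cast hN
  have hr : 0 ≤ (N : ℝ) - ε := by linarith [hu.le_one]
  obtain ⟨R, hR0, hR⟩ := hs.isCompact.isBounded.exists_pos_norm_lt
  -- For `|x| ≥ 1 + 2R` and `|y| < R`, the distance `|x-y|` is at least `1` and at least `(1 +
  -- |x|)/4`.
  set R' := 1 + 2 * R with hR'
  have hB0 : 0 ≤ B := (majorant_nonneg ε 0).trans (hB 0)
  have hi : Integrable u := hu.continuous.integrable_of_hasCompactSupport hs
  have hI : 0 ≤ ∫ y, |u y| := integral_nonneg fun _ => abs_nonneg _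
  have hfar (x : EuclideanSpace ℝ (Fin N)) (hx : R' ≤ ‖x‖) :
      majorant ε u x ≤ (1 + ‖x‖) ^ (-((N : ℝ) - ε)) * (4 ^ ((N : ℝ) - ε) * ∫ y, |u y|) := by
    have hux : u x = 0 := by
      by_contra h
      have := hR x (subset_tsupport u h)
      linarith
    rw [← mul_assoc, ← integral_const_mul]
    refine integral_mono (hu.integrable x) (hi.abs.const_mul _) fun y => ?_
    by_cases hy : u y = 0
    · have : cutDiff u x y = 0 := by simp [cutDiff, hux, hy]
      simp [this, hy]
    · have hy' := hR y (subset_tsupport u hy)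
      have hxy : (1 + ‖x‖) / 4 ≤ ‖x - y‖ := by
        have := norm_sub_norm_le x y
        linarith
      have hxy1 : 1 ≤ ‖x - y‖ := by
        have := norm_sub_norm_le x y
        linarith
      simp only
      rw [cutDiff_of_le hxy1, abs_neg, mul_comm, logWeight_of_one_le hxy1]
      gcongr
      calc ‖x - y‖ ^ (-(N : ℝ) + ε) ≤ ((1 + ‖x‖) / 4) ^ (-(N : ℝ) + ε) :=
            Real.rpow_le_rpow_of_nonpos (by positivity) hxy (by linarith)
        _ = _ := by
          rw [div_eq_mul_inv, Real.mul_rpow (by positivity) (by positivity), Real.inv_rpow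
            (by norm_num), ← Real.rpow_neg (by norm_num)]
          ring_nf
  refine ⟨B * (1 + R') ^ ((N : ℝ) - ε) + 4 ^ ((N : ℝ) - ε) * ∫ y, |u y|, by positivity,
    fun x => ?_⟩
  have hp : (0 : ℝ) ≤ (1 + ‖x‖) ^ (-((N : ℝ) - ε)) := by positivity
  rw [add_mul]
  rcases le_total R' ‖x‖ with hx | hx
  · have : 0 ≤ B * (1 + R') ^ ((N : ℝ) - ε) * (1 + ‖x‖) ^ (-((N : ℝ) - ε)) := by positivity
    linarith [hfar x hx]
  · have h1 : 1 ≤ (1 + R') ^ ((N : ℝ) - ε) * (1 + ‖x‖) ^ (-((N : ℝ) - ε)) := by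
      rw [Real.rpow_neg (by positivity), ← div_eq_mul_inv, one_le_div (by positivity)]
      gcongr
    have h2 : 0 ≤ 4 ^ ((N : ℝ) - ε) * (∫ y, |u y|) * (1 + ‖x‖) ^ (-((N : ℝ) - ε)) := by positivity
    have h3 := mul_le_mul_of_nonneg_left h1 hB0
    linarith [hB x]

lemma memLp_one_add_norm_rpow {r : ℝ} (hr : 0 ≤ r) {p : ℝ≥0∞} (hp0 : p ≠ 0)
    (hp : p = ∞ ∨ (N : ℝ) < r * p.toReal) :
    MemLp (fun x : EuclideanSpace ℝ (Fin N) => (1 + ‖x‖) ^ (-r)) p := by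
  have hm : AEStronglyMeasurable (fun x : EuclideanSpace ℝ (Fin N) => (1 + ‖x‖) ^ (-r)) volume :=
    (Measurable.pow_const (by fun_prop) _).aestronglyMeasurable
  rcases eq_or_ne p ∞ with rfl | hpt
  · refine memLp_top_of_bound hm 1 (Eventually.of_forall fun x => ?_)
    rw [Real.norm_of_nonneg (by positivity)]
    exact Real.rpow_le_one_of_one_le_of_nonpos (by linarith [norm_nonneg x]) (by linarith)
  · have h := hp.resolve_left hpt
    rw [← integrable_norm_rpow_iff hm hp0 hpt]
    refine (integrable_one_add_norm (E := EuclideanSpace ℝ (Fin N)) (μ := volume)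
      (r := r * p.toReal) (by simpa using h)).congr (Eventually.of_forall fun x => ?_)
    simp only
    rw [Real.norm_of_nonneg (by positivity), ← Real.rpow_mul (by positivity), neg_mul]

lemma memLp_majorant_of_hasCompactSupport {ε B : ℝ} (hN : 1 ≤ N) (hu : Admissible ε u)
    (hs : HasCompactSupport u) (hB : ∀ x, majorant ε u x ≤ B) {p : ℝ≥0∞} (hp0 : p ≠ 0)
    (hp : p = ∞ ∨ (N : ℝ) < (N - ε) * p.toReal) : MemLp (majorant ε u) p := by
  have hN' : (1 : ℝ) ≤ N := by exact_mod_cast hN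
  obtain ⟨C, hC0, hC⟩ := exists_majorant_le_of_hasCompactSupport hN hu hs hB
  refine ((memLp_one_add_norm_rpow (N := N) (r := N - ε) (by linarith [hu.le_one]) hp0
    hp).const_mul C).mono
    (measurable_majorant hu.continuous.measurable ε).aestronglyMeasurable
    (Eventually.of_forall fun x => ?_)
  rw [Real.norm_of_nonneg (majorant_nonneg _ _), Real.norm_of_nonneg (by positivity)]
  exact hC x

end LogLap

namespace LogLap

variable {N : ℕ} {u : EuclideanSpace ℝ (Fin N) → ℝ}

/-! ### Integrability of the logarithmic Laplacians and the expansion in `L^p` -/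

lemma logLap_eq_iteratedDeriv (hN : 1 ≤ N) {ε : ℝ} (hu : Admissible ε u) {m : ℕ} (hm : 1 ≤ m)
    (x : EuclideanSpace ℝ (Fin N)) :
    logLap N m u x = (-1) ^ m * iteratedDeriv m (rieszExt u x) 0 := by
  rw [iteratedDeriv_rieszExt_zero hN hu x hm, ← mul_assoc, ← mul_pow]
  simp

lemma measurable_logLap (hN : 1 ≤ N) {ε : ℝ} (hu : Admissible ε u) {m : ℕ} (hm : 1 ≤ m) :
    Measurable (logLap N m u) := by
  have hε := hu.pos
  rw [funext (logLap_eq_iteratedDeriv hN hu hm)]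
  exact (measurable_iteratedDeriv_rieszExt hN hu m ⟨by linarith, by linarith⟩).const_mul _

lemma memLp_of_iteratedDeriv_bound {C ε : ℝ} {f : EuclideanSpace ℝ (Fin N) → ℝ} {p : ℝ≥0∞}
    (hf : Measurable f) (hup : MemLp u p) (hMp : MemLp (majorant ε u) p)
    (h : ∀ x, |f x| ≤ C * (|u x| + majorant ε u x)) : MemLp f p :=
  ((hup.norm.add hMp).const_mul C).mono hf.aestronglyMeasurable
    (Eventually.of_forall fun x => (h x).trans (le_abs_self _))

lemma memLp_logLap (hN : 1 ≤ N) {ε : ℝ} (hu : Admissible ε u) {m : ℕ} (hm : 1 ≤ m) {p : ℝ≥0∞}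
    (hup : MemLp u p) (hMp : MemLp (majorant ε u) p) : MemLp (logLap N m u) p := by
  have hε := hu.pos
  obtain ⟨C, -, hC⟩ := exists_abs_iteratedDeriv_rieszExt_le hN hu m
  refine memLp_of_iteratedDeriv_bound (C := C) (measurable_logLap hN hu hm) hup hMp fun x => ?_
  rw [logLap_eq_iteratedDeriv hN hu hm, abs_mul, abs_pow, abs_neg, abs_one, one_pow, one_mul]
  exact hC 0 ⟨by linarith, by linarith⟩ x

/-- Taylor's formula for the Riesz potentials, with a remainder uniform in the order. -/
lemma exists_abs_taylorQuotient_sub_le (hN : 1 ≤ N) {ε : ℝ} (hu : Admissible ε u) {B : ℝ}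
    (hb : ∀ x, |u x| ≤ B) (hi : Integrable u) {m : ℕ} (hm : 1 ≤ m) :
    ∃ C, 0 ≤ C ∧ ∀ s ∈ Ioo 0 (ε / 8), ∀ x,
      |taylorQuotient N m u s x - (-1) ^ m * logLap N m u x| ≤
        s * (C * (|u x| + majorant ε u x)) := by
  have hN' : (1 : ℝ) ≤ N := by exact_mod_cast hN
  have hε := hu.pos
  obtain ⟨C, hC0, hC⟩ := exists_abs_iteratedDeriv_rieszExt_le hN hu (m + 1)
  refine ⟨C, hC0, fun s hs x => ?_⟩
  have hs0 := hs.1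
  have hsub : Icc 0 s ⊆ Ioo (-(ε / 4)) (ε / 4) := fun t ht =>
    ⟨by linarith [ht.1], by linarith [ht.2, hs.2]⟩
  have hd (k : ℕ) {t : ℝ} (ht : t ∈ Icc 0 s) :
      iteratedDerivWithin k (rieszExt u x) (Icc 0 s) t = iteratedDeriv k (rieszExt u x) t :=
    iteratedDerivWithin_eq_iteratedDeriv (uniqueDiffOn_Icc hs0)
      (((contDiffOn_rieszExt hN hu x).contDiffAt (isOpen_Ioo.mem_nhds (hsub ht))).of_le
        (by exact_mod_cast le_top)) ht
  -- The remainder is `O(s^{m+1}) / m!`, so the prefactor `m!/s^m` leaves a single factor `s`.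
  have hT := taylor_mean_remainder_bound (n := m) (C := C * (|u x| + majorant ε u x)) hs0.le
    (((contDiffOn_rieszExt hN hu x).mono hsub).of_le (by exact_mod_cast le_top))
    (right_mem_Icc.2 hs0.le) (fun t ht => by
      rw [hd _ ht]
      exact hC t ⟨by linarith [ht.1], by linarith [ht.2, hs.2]⟩ x)
  have e : taylorWithinEval (rieszExt u x) m (Icc 0 s) 0 s = u x +
      ∑ j ∈ Finset.Ico 1 m, (-1) ^ j * s ^ j / (j.factorial : ℝ) * logLap N j u x +
      s ^ m / m.factorial * ((-1) ^ m * logLap N m u x) := by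
    rw [taylor_within_apply, Finset.sum_range_succ, Finset.range_eq_Ico,
      Finset.sum_eq_sum_Ico_succ_bot (by omega)]
    congr 1
    · congr 1
      · simp [rieszExt_zero hN]
      · refine Finset.sum_congr rfl fun j hj => ?_
        rw [hd _ (left_mem_Icc.2 hs0.le),
          iteratedDeriv_rieszExt_zero hN hu x (by simpa using (Finset.mem_Ico.1 hj).1)]
        simp only [sub_zero, smul_eq_mul]
        ring
    · rw [hd _ (left_mem_Icc.2 hs0.le), iteratedDeriv_rieszExt_zero hN hu x hm]
      simp only [sub_zero, smul_eq_mul]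
      ring
  have hfac : (0 : ℝ) < m.factorial := by positivity
  have e2 : taylorQuotient N m u s x - (-1) ^ m * logLap N m u x =
      m.factorial / s ^ m * (rieszExt u x s - taylorWithinEval (rieszExt u x) m (Icc 0 s) 0 s) := by
    rw [e, taylorQuotient, rieszConv_eq_rieszExt hN hb hi ⟨hs0, by linarith [hs.2, hu.le_one]⟩]
    field_simp
    ring
  rw [e2, abs_mul, abs_of_pos (by positivity)]
  rw [Real.norm_eq_abs, sub_zero] at hT
  calc m.factorial / s ^ m * |rieszExt u x s - taylorWithinEval (rieszExt u x) m (Icc 0 s) 0 s|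
      ≤ m.factorial / s ^ m *
          (C * (|u x| + majorant ε u x) * s ^ (m + 1) / m.factorial) := by gcongr
    _ = _ := by field_simp; ring

lemma measurable_taylorQuotient (hN : 1 ≤ N) {ε : ℝ} (hu : Admissible ε u) {B : ℝ}
    (hb : ∀ x, |u x| ≤ B) (hi : Integrable u) (m : ℕ) {s : ℝ} (hs : s ∈ Ioo 0 (ε / 8)) :
    Measurable (taylorQuotient N m u s) := by
  have hN' : (1 : ℝ) ≤ N := by exact_mod_cast hN
  have hr : Measurable (rieszConv N s u) := by
    have : rieszConv N s u = fun x => iteratedDeriv 0 (rieszExt u x) s := by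
      ext x
      rw [iteratedDeriv_zero, rieszConv_eq_rieszExt hN hb hi
        ⟨hs.1, by linarith [hs.2, hu.le_one]⟩]
    rw [this]
    exact measurable_iteratedDeriv_rieszExt hN hu 0 ⟨by linarith [hs.1, hu.pos],
      by linarith [hs.2, hu.pos]⟩
  refine ((hr.sub hu.continuous.measurable).sub (Finset.measurable_sum _ fun j hj => ?_)).const_mul _
  exact (measurable_logLap hN hu (Finset.mem_Ico.1 hj).1).const_mul _

/-- The error is pointwise at most `s` times one fixed function in `L^p`. -/
lemma taylorQuotient_expansion (hN : 1 ≤ N) {ε : ℝ} (hu : Admissible ε u) {B : ℝ}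
    (hb : ∀ x, |u x| ≤ B) (hi : Integrable u) {m : ℕ} (hm : 1 ≤ m) {p : ℝ≥0∞}
    (hup : MemLp u p) (hMp : MemLp (majorant ε u) p) :
    (∀ᶠ s in 𝓝[>] (0 : ℝ), MemLp (taylorQuotient N m u s) p volume) ∧
      Tendsto (fun s : ℝ => eLpNorm
          (fun x => taylorQuotient N m u s x - (-1) ^ m * logLap N m u x) p volume)
        (𝓝[>] (0 : ℝ)) (𝓝 0) := by
  have hε := hu.pos
  obtain ⟨C, hC0, hC⟩ := exists_abs_taylorQuotient_sub_le hN hu hb hi hm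
  have hev : ∀ᶠ s in 𝓝[>] (0 : ℝ), s ∈ Ioo 0 (ε / 8) := Ioo_mem_nhdsGT (by linarith)
  have hL := memLp_logLap hN hu hm hup hMp
  refine ⟨?_, ?_⟩
  · filter_upwards [hev] with s hs
    have h1 : MemLp (fun x => taylorQuotient N m u s x - (-1) ^ m * logLap N m u x) p :=
      memLp_of_iteratedDeriv_bound (C := s * C) ((measurable_taylorQuotient hN hu hb hi m hs).sub
        ((measurable_logLap hN hu hm).const_mul _)) hup hMp fun x => by
          rw [mul_assoc]; exact hC s hs x
    refine (h1.add (hL.const_mul ((-1) ^ m))).congr_norm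
      (measurable_taylorQuotient hN hu hb hi m hs).aestronglyMeasurable
      (Eventually.of_forall fun x => ?_)
    simp
  · set K := eLpNorm (fun x => C * (|u x| + majorant ε u x)) p volume with hK
    have hKt : K ≠ ∞ := ((hup.norm.add hMp).const_mul C).eLpNorm_ne_top
    have hlim : Tendsto (fun s : ℝ => ENNReal.ofReal s * K) (𝓝[>] (0 : ℝ)) (𝓝 0) := by
      have : Tendsto (fun s : ℝ => ENNReal.ofReal s) (𝓝[>] (0 : ℝ)) (𝓝 0) := by
        simpa using (ENNReal.tendsto_ofReal (tendsto_id (α := ℝ) (x := 𝓝 0))).mono_left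
          nhdsWithin_le_nhds
      simpa using ENNReal.Tendsto.mul_const this (Or.inr hKt)
    refine tendsto_of_tendsto_of_tendsto_of_le_of_le' tendsto_const_nhds hlim
      (Eventually.of_forall fun _ => zero_le) ?_
    filter_upwards [hev] with s hs
    refine (eLpNorm_mono_real (hC s hs)).trans ?_
    have := eLpNorm_const_smul s (fun x => C * (|u x| + majorant ε u x)) p volume
    rw [Real.enorm_of_nonneg hs.1.le] at this
    exact this.le

end LogLap

namespace LogLap

variable {N : ℕ}

/-! ### The Fourier transform of the Riesz kernel -/

lemma integrable_rpow_mul_exp_neg_mul {a c : ℝ} (ha : 0 < a) (hc : 0 < c) :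
    IntegrableOn (fun t : ℝ => t ^ (a - 1) * Real.exp (-(c * t))) (Ioi 0) := by
  -- The Bochner integral of a non-integrable function is `0`, so a nonzero value proves
  -- integrability.
  refine Integrable.of_integral_ne_zero ?_
  rw [Real.integral_rpow_mul_exp_neg_mul_Ioi ha hc]
  have := Real.Gamma_pos_of_pos ha
  positivity

/-- The substitution `t ↦ 1/t` in the Gamma integral. -/
lemma integral_rpow_mul_exp_neg_div {a c : ℝ} (ha : 0 < a) (hc : 0 < c) :
    ∫ t : ℝ in Ioi 0, t ^ (-a - 1) * Real.exp (-(c / t)) = (1 / c) ^ a * Real.Gamma a := by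
  rw [← Real.integral_rpow_mul_exp_neg_mul_Ioi ha hc,
    ← integral_comp_rpow_Ioi _ (show (-1 : ℝ) ≠ 0 by norm_num)]
  refine setIntegral_congr_fun measurableSet_Ioi fun t ht => ?_
  have ht' : (0 : ℝ) < t := ht
  simp only [abs_neg, abs_one, one_mul, smul_eq_mul, Real.rpow_neg_one, div_inv_eq_mul]
  rw [← mul_assoc, ← Real.rpow_neg_one t, ← Real.rpow_mul ht'.le, ← Real.rpow_add ht']
  ring_nf

lemma integrable_rpow_mul_exp_neg_div {a c : ℝ} (ha : 0 < a) (hc : 0 < c) :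
    IntegrableOn (fun t : ℝ => t ^ (-a - 1) * Real.exp (-(c / t))) (Ioi 0) := by
  refine Integrable.of_integral_ne_zero ?_
  rw [integral_rpow_mul_exp_neg_div ha hc]
  have := Real.Gamma_pos_of_pos ha
  positivity

/-- Integration against a superposition of nonnegative kernels. -/
lemma integral_superposition {X T : Type*} [MeasurableSpace X] [MeasurableSpace T]
    {μ : Measure X} [SFinite μ] {ν : Measure T} [SFinite ν] {k : X → T → ℝ}
    (hk : Measurable (Function.uncurry k)) (hk0 : ∀ x, ∀ᵐ t ∂ν, 0 ≤ k x t)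
    (hki : ∀ᵐ x ∂μ, Integrable (k x) ν) {φ : X → ℂ} (hφ : AEStronglyMeasurable φ μ)
    (hi : Integrable (fun x => ((∫ t, k x t ∂ν : ℝ) : ℂ) * φ x) μ) :
    ∫ x, ((∫ t, k x t ∂ν : ℝ) : ℂ) * φ x ∂μ = ∫ t, ∫ x, (k x t : ℂ) * φ x ∂μ ∂ν := by
  -- Since `k ≥ 0`, integrating `|k φ|` in `t` gives `(∫ k) |φ|`, so joint integrability follows
  -- from `hi`.
  have hint : Integrable (Function.uncurry fun x t => (k x t : ℂ) * φ x) (μ.prod ν) := by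
    rw [integrable_prod_iff]
    · refine ⟨?_, ?_⟩
      · filter_upwards [hki] with x hx
        exact (Integrable.ofReal (𝕜 := ℂ) hx).mul_const (φ x)
      · refine hi.norm.congr ?_
        filter_upwards with x
        simp only [Function.uncurry_apply_pair, norm_mul]
        rw [integral_mul_const, Complex.norm_real, Real.norm_of_nonneg
          (integral_nonneg_of_ae (hk0 x))]
        congr 1
        refine integral_congr_ae ?_
        filter_upwards [hk0 x] with t ht
        rw [Complex.norm_real, Real.norm_of_nonneg ht]
    · exact (Complex.measurable_ofReal.comp hk).aestronglyMeasurable.mul hφ.comp_fst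
  rw [← integral_integral_swap hint]
  congr 1
  ext x
  rw [integral_mul_const, integral_complex_ofReal]

/-- The multiplication formula `∫ 𝓕φ G = ∫ φ 𝓕G` for a Gaussian `G`, whose transform is explicit. -/
lemma integral_gaussian_mul_fourier {φ : EuclideanSpace ℝ (Fin N) → ℂ} (hφ : Integrable φ) {t : ℝ}
    (ht : 0 < t) :
    ∫ x, (Real.exp (-(Real.pi * ‖x‖ ^ 2 * t)) : ℂ) * 𝓕 φ x =
      ∫ ξ, ((t ^ (-((N : ℝ) / 2)) * Real.exp (-(Real.pi * ‖ξ‖ ^ 2 / t)) : ℝ) : ℂ) * φ ξ := by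
  have hb : 0 < ((Real.pi * t : ℝ) : ℂ).re := by rw [Complex.ofReal_re]; positivity
  set G : EuclideanSpace ℝ (Fin N) → ℂ := fun v => Complex.exp (-((Real.pi * t : ℝ) : ℂ) * ‖v‖ ^ 2)
    with hG
  have hGi : Integrable G := by
    simpa [hG] using GaussianFourier.integrable_cexp_neg_mul_sq_norm_add (V := EuclideanSpace ℝ (Fin N))
      hb 0 0
  have h := VectorFourier.integral_fourierIntegral_smul_eq_flip (L := innerₗ _) (f := φ) (g := G)
    Real.continuous_fourierChar continuous_inner hφ hGi
  have hF (ξ) : 𝓕 G ξ =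
      ((t ^ (-((N : ℝ) / 2)) * Real.exp (-(Real.pi * ‖ξ‖ ^ 2 / t)) : ℝ) : ℂ) := by
    rw [hG, fourier_gaussian_innerProductSpace hb]
    push_cast [Complex.ofReal_cpow ht.le]
    congr 1
    · rw [finrank_euclideanSpace, Fintype.card_fin]
      have : (Real.pi : ℂ) / (Real.pi * t) = ((t⁻¹ : ℝ) : ℂ) := by
        have := Real.pi_ne_zero
        push_cast
        field_simp
      rw [this]
      have e : ((N : ℂ) / 2) = ((N / 2 : ℝ) : ℂ) := by push_cast; rfl
      rw [e, ← Complex.ofReal_cpow (by positivity), Real.inv_rpow ht.le, ← Real.rpow_neg ht.le,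
        Complex.ofReal_cpow ht.le]
      push_cast; rfl
    · congr 1
      have h1 : (Real.pi : ℂ) ≠ 0 := by exact_mod_cast Real.pi_ne_zero
      have h2 : (t : ℂ) ≠ 0 := by exact_mod_cast ht.ne'
      field_simp
  have e1 : ∫ x, (Real.exp (-(Real.pi * ‖x‖ ^ 2 * t)) : ℂ) * 𝓕 φ x = ∫ x, 𝓕 φ x • G x := by
    congr 1; ext x
    rw [hG, smul_eq_mul, mul_comm]
    congr 1
    push_cast
    congr 1; ring
  rw [e1]
  refine h.trans ?_
  congr 1; ext ξ
  rw [smul_eq_mul, mul_comm, ← hF ξ]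
  congr 1
  simp only [Real.fourier_eq, VectorFourier.fourierIntegral]
  congr 1; ext v
  rw [LinearMap.flip_apply, innerₗ_apply_apply, real_inner_comm]

lemma integrable_norm_rpow_mul_complex (hN : 1 ≤ N) {φ : EuclideanSpace ℝ (Fin N) → ℂ} {C : ℝ}
    (hb : ∀ x, ‖φ x‖ ≤ C) (hi : Integrable φ) {b : ℝ} (hb0 : -(N : ℝ) < b) (hb1 : b ≤ 0) :
    Integrable fun x => ((‖x‖ ^ b : ℝ) : ℂ) * φ x := by
  have h1 := integrable_indicator_ball_norm_rpow (N := N) hN hb0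
  refine ((h1.const_mul C).add hi.norm).mono' ?_ (Eventually.of_forall fun x => ?_)
  · exact (Complex.measurable_ofReal.comp (measurable_norm.pow_const _)).aestronglyMeasurable.mul
      hi.aestronglyMeasurable
  · have hC : 0 ≤ C := (norm_nonneg _).trans (hb 0)
    simp only [norm_mul, Pi.add_apply, Complex.norm_real]
    rw [Real.norm_of_nonneg (by positivity)]
    by_cases h : ‖x‖ < 1
    · rw [indicator_of_mem (by simpa using h)]
      have := hb x
      calc ‖x‖ ^ b * ‖φ x‖ ≤ ‖x‖ ^ b * C := by gcongr
        _ ≤ _ := by linarith [norm_nonneg (φ x)]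
    · rw [indicator_of_notMem (by simpa using h), mul_zero, zero_add]
      exact mul_le_of_le_one_left (norm_nonneg _)
        (Real.rpow_le_one_of_one_le_of_nonpos (not_lt.1 h) hb1)

/-- The Fourier transform of the Riesz kernel `Φ_s` is `|2πξ|^{-2s}`. -/
lemma integral_rieszKernel_mul_fourier (hN : 1 ≤ N) {φ : EuclideanSpace ℝ (Fin N) → ℂ} {C : ℝ}
    (hb : ∀ x, ‖φ x‖ ≤ C) (hφ : Integrable φ) (hF : Integrable (𝓕 φ)) {s : ℝ}
    (hs : s ∈ Ioo (0 : ℝ) (N / 2)) :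
    ∫ x, (rieszKernel N s x : ℂ) * 𝓕 φ x =
      ∫ ξ, (((2 * Real.pi * ‖ξ‖) ^ (-(2 * s)) : ℝ) : ℂ) * φ ξ := by
  have : Nonempty (Fin N) := ⟨⟨0, hN⟩⟩
  obtain ⟨hs0, hs1⟩ := hs
  have hpi := Real.pi_pos
  -- Both `|x|^{2s-N}` and `|ξ|^{-2s}` are superpositions of Gaussians, with densities `t^{a-1}` and
  -- `t^{-s-1}`.
  set a : ℝ := N / 2 - s with ha
  have ha0 : 0 < a := by linarith
  have hne : ∀ᵐ x : EuclideanSpace ℝ (Fin N), x ≠ 0 := by simp [ae_iff]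
  have hpos : ∀ᵐ t ∂(volume.restrict (Ioi (0 : ℝ))), 0 < t :=
    ae_restrict_mem measurableSet_Ioi
  have hΓa := Real.Gamma_pos_of_pos ha0
  have hΓs := Real.Gamma_pos_of_pos hs0
  have hFb (x) : ‖𝓕 φ x‖ ≤ ∫ v, ‖φ v‖ :=
    VectorFourier.norm_fourierIntegral_le_integral_norm _ _ _ _ _
  have norm_pow (b : ℝ) (x : EuclideanSpace ℝ (Fin N)) :
      (1 / (Real.pi * ‖x‖ ^ 2)) ^ b = Real.pi ^ (-b) * ‖x‖ ^ (-(2 * b)) := by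
    rw [one_div, ← Real.rpow_neg_one, ← Real.rpow_mul (by positivity), Real.mul_rpow (by positivity)
      (by positivity), ← Real.rpow_natCast_mul (by positivity)]
    ring_nf
  have h1 (x : EuclideanSpace ℝ (Fin N)) (hx : x ≠ 0) :
      ∫ t in Ioi 0, t ^ (a - 1) * Real.exp (-(Real.pi * ‖x‖ ^ 2 * t)) =
        Real.pi ^ (-a) * Real.Gamma a * ‖x‖ ^ (2 * s - (N : ℝ)) := by
    have := norm_pos_iff.2 hx
    rw [Real.integral_rpow_mul_exp_neg_mul_Ioi ha0 (by positivity), norm_pow]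
    have : -(2 * a) = 2 * s - N := by rw [ha]; ring
    rw [this]; ring
  have h2 (x : EuclideanSpace ℝ (Fin N)) (hx : x ≠ 0) :
      ∫ t in Ioi 0, t ^ (-s - 1) * Real.exp (-(Real.pi * ‖x‖ ^ 2 / t)) =
        Real.pi ^ (-s) * Real.Gamma s * ‖x‖ ^ (-(2 * s)) := by
    have := norm_pos_iff.2 hx
    rw [integral_rpow_mul_exp_neg_div hs0 (by positivity), norm_pow]
    ring
  have i1 := integrable_norm_rpow_mul_complex hN hFb hF (b := 2 * s - N) (by linarith)
    (by linarith)
  have i2 := integrable_norm_rpow_mul_complex hN hb hφ (b := -(2 * s)) (by linarith) (by linarith)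
  have e1 : (fun x : EuclideanSpace ℝ (Fin N) => ((∫ t in Ioi 0, t ^ (a - 1) *
      Real.exp (-(Real.pi * ‖x‖ ^ 2 * t)) : ℝ) : ℂ) * 𝓕 φ x) =ᵐ[volume] fun x =>
      ((Real.pi ^ (-a) * Real.Gamma a : ℝ) : ℂ) * (((‖x‖ ^ (2 * s - (N : ℝ)) : ℝ) : ℂ) * 𝓕 φ x) := by
    filter_upwards [hne] with x hx
    rw [h1 x hx]; push_cast; ring
  have e2 : (fun x : EuclideanSpace ℝ (Fin N) => ((∫ t in Ioi 0, t ^ (-s - 1) *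
      Real.exp (-(Real.pi * ‖x‖ ^ 2 / t)) : ℝ) : ℂ) * φ x) =ᵐ[volume] fun x =>
      ((Real.pi ^ (-s) * Real.Gamma s : ℝ) : ℂ) * (((‖x‖ ^ (-(2 * s)) : ℝ) : ℂ) * φ x) := by
    filter_upwards [hne] with x hx
    rw [h2 x hx]; push_cast; ring
  have s1 := integral_superposition (ν := volume.restrict (Ioi (0 : ℝ)))
    (k := fun (x : EuclideanSpace ℝ (Fin N)) t => t ^ (a - 1) * Real.exp (-(Real.pi * ‖x‖ ^ 2 * t)))
    ((measurable_snd.pow_const _).mul (by fun_prop))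
    (fun x => hpos.mono fun t ht => by positivity)
    (hne.mono fun x hx => integrable_rpow_mul_exp_neg_mul ha0
      (by have := norm_pos_iff.2 hx; positivity)) hF.aestronglyMeasurable
    ((i1.const_mul _).congr e1.symm)
  have s2 := integral_superposition (ν := volume.restrict (Ioi (0 : ℝ)))
    (k := fun (x : EuclideanSpace ℝ (Fin N)) t =>
      t ^ (-s - 1) * Real.exp (-(Real.pi * ‖x‖ ^ 2 / t)))
    ((measurable_snd.pow_const _).mul (by fun_prop))
    (fun x => hpos.mono fun t ht => by positivity)
    (hne.mono fun x hx => integrable_rpow_mul_exp_neg_div hs0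
      (by have := norm_pos_iff.2 hx; positivity)) hφ.aestronglyMeasurable
    ((i2.const_mul _).congr e2.symm)
  -- For each `t` the Gaussian formula contributes `t^{-N/2}`, and `a - 1 - N/2 = -s - 1`.
  have hmid : ∫ t in Ioi 0, ∫ x : EuclideanSpace ℝ (Fin N),
      ((t ^ (a - 1) * Real.exp (-(Real.pi * ‖x‖ ^ 2 * t)) : ℝ) : ℂ) * 𝓕 φ x =
      ∫ t in Ioi 0, ∫ x : EuclideanSpace ℝ (Fin N),
      ((t ^ (-s - 1) * Real.exp (-(Real.pi * ‖x‖ ^ 2 / t)) : ℝ) : ℂ) * φ x := by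
    refine setIntegral_congr_fun measurableSet_Ioi fun t ht => ?_
    have ht' : (0 : ℝ) < t := ht
    simp only [Complex.ofReal_mul, mul_assoc]
    rw [integral_const_mul, integral_const_mul]
    have := integral_gaussian_mul_fourier hφ ht'
    simp only [Complex.ofReal_mul, mul_assoc] at this
    rw [this, integral_const_mul, ← mul_assoc, ← Complex.ofReal_mul, ← Real.rpow_add ht']
    congr 3
    rw [ha]; ring
  rw [integral_congr_ae e1, integral_const_mul] at s1
  rw [integral_congr_ae e2, integral_const_mul] at s2
  rw [hmid, ← s2] at s1
  -- `κ_{N,s}` is exactly the constant left by the two Gamma integrals; its factor `s` is absorbed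
  -- by `Γ(1+s) = s Γ(s)`.
  have hk : kappaN N s = (2 * Real.pi) ^ (-(2 * s)) * ((Real.pi ^ (-a) * Real.Gamma a) /
      (Real.pi ^ (-s) * Real.Gamma s)) := by
    have hG1 : Real.Gamma (1 + s) = s * Real.Gamma s := by
      rw [add_comm, Real.Gamma_add_one hs0.ne']
    have hG2 : ((N : ℝ) - 2 * s) / 2 = a := by rw [ha]; ring
    have hp : Real.pi ^ (-(2 * s)) * Real.pi ^ (-a) = Real.pi ^ (-((N : ℝ) / 2)) * Real.pi ^ (-s) := by
      rw [← Real.rpow_add hpi, ← Real.rpow_add hpi, ha]; congr 1; ring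
    have hps : (0 : ℝ) < Real.pi ^ (-s) := by positivity
    rw [kappaN, hG1, hG2, Real.mul_rpow (by norm_num) hpi.le, neg_mul, neg_div]
    field_simp
    linear_combination -hp
  have hps : ((Real.pi ^ (-s) * Real.Gamma s : ℝ) : ℂ) ≠ 0 := by
    have : (0 : ℝ) < Real.pi ^ (-s) := by positivity
    exact_mod_cast (mul_pos this hΓs).ne'
  calc ∫ x, (rieszKernel N s x : ℂ) * 𝓕 φ x
      = (kappaN N s : ℂ) * ∫ x, ((‖x‖ ^ (2 * s - (N : ℝ)) : ℝ) : ℂ) * 𝓕 φ x := by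
        rw [← integral_const_mul]
        simp only [rieszKernel, Complex.ofReal_mul, mul_assoc]
    _ = (((2 * Real.pi) ^ (-(2 * s)) : ℝ) : ℂ) * ∫ x, ((‖x‖ ^ (-(2 * s)) : ℝ) : ℂ) * φ x := by
        rw [hk, Complex.ofReal_mul, Complex.ofReal_div, mul_assoc]
        congr 1
        rw [div_mul_eq_mul_div, s1, mul_div_cancel_left₀ _ hps]
    _ = _ := by
        rw [← integral_const_mul]
        congr 1; ext x
        rw [Real.mul_rpow (by positivity) (norm_nonneg _), Complex.ofReal_mul, mul_assoc]

end LogLap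

namespace LogLap

variable {N : ℕ} {u : EuclideanSpace ℝ (Fin N) → ℝ}

/-! ### The Fourier transform of the Riesz potentials -/

lemma norm_fourier_le_integral {φ : EuclideanSpace ℝ (Fin N) → ℂ} (x : EuclideanSpace ℝ (Fin N)) :
    ‖𝓕 φ x‖ ≤ ∫ v, ‖φ v‖ :=
  VectorFourier.norm_fourierIntegral_le_integral_norm _ _ _ _ _

lemma fourier_modulation (φ : EuclideanSpace ℝ (Fin N) → ℂ) (x y : EuclideanSpace ℝ (Fin N)) :
    𝓕 (fun ξ => Real.fourierChar (-inner ℝ ξ y) • φ ξ) x = 𝓕 φ (x + y) := by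
  simp only [Real.fourier_eq, smul_smul, ← AddChar.map_add_eq_mul, inner_add_right, neg_add]

/-- Modulating `φ` translates `𝓕 φ`, which reduces to the kernel centred at the origin. -/
lemma integral_rieszKernel_sub_mul_fourier (hN : 1 ≤ N) {φ : EuclideanSpace ℝ (Fin N) → ℂ} {C : ℝ}
    (hb : ∀ x, ‖φ x‖ ≤ C) (hφ : Integrable φ) (hF : Integrable (𝓕 φ)) {s : ℝ}
    (hs : s ∈ Ioo (0 : ℝ) (N / 2)) (y : EuclideanSpace ℝ (Fin N)) :
    ∫ x, (rieszKernel N s (x - y) : ℂ) * 𝓕 φ x =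
      ∫ ξ, (((2 * Real.pi * ‖ξ‖) ^ (-(2 * s)) : ℝ) : ℂ) *
        (Real.fourierChar (-inner ℝ ξ y) • φ ξ) := by
  have hm : Continuous fun ξ : EuclideanSpace ℝ (Fin N) =>
      (Real.fourierChar (-inner ℝ ξ y) : ℂ) := by
    exact continuous_subtype_val.comp (Real.continuous_fourierChar.comp (by fun_prop))
  rw [← integral_rieszKernel_mul_fourier hN (φ := fun ξ => Real.fourierChar (-inner ℝ ξ y) • φ ξ)
    (C := C) (by simpa using hb) ?_ ?_ hs]
  · simp_rw [fourier_modulation]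
    rw [← integral_add_right_eq_self _ y]
    simp
  · refine (hφ.bdd_mul (c := 1) hm.aestronglyMeasurable (Eventually.of_forall fun ξ => ?_))
    exact (Circle.norm_coe _).le
  · have : 𝓕 (fun ξ => Real.fourierChar (-inner ℝ ξ y) • φ ξ) = fun x => 𝓕 φ (x + y) :=
      funext fun x => fourier_modulation φ x y
    rw [this]
    exact hF.comp_add_right y

lemma abs_rieszKernel_le {s : ℝ} (hs : s ∈ Ioo (0 : ℝ) (N / 2)) (z : EuclideanSpace ℝ (Fin N)) :
    |rieszKernel N s z| ≤ |kappaN N s| *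
      ((Metric.ball (0 : EuclideanSpace ℝ (Fin N)) 1).indicator
        (fun z => ‖z‖ ^ (2 * s - (N : ℝ))) z + 1) := by
  rw [rieszKernel, abs_mul]
  gcongr
  rw [abs_of_nonneg (by positivity)]
  by_cases h : ‖z‖ < 1
  · rw [indicator_of_mem (by simpa using h)]
    linarith
  · rw [indicator_of_notMem (by simpa using h), zero_add]
    exact Real.rpow_le_one_of_one_le_of_nonpos (not_lt.1 h) (by linarith [hs.2])

/-- Justifies Fubini: the kernel is bounded by an integrable part on the ball plus a constant,
giving a convolution integrand and a product of integrable functions. -/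
lemma integrable_rieszKernel_mul_mul (hN : 1 ≤ N) (hi : Integrable u)
    {ψ : EuclideanSpace ℝ (Fin N) → ℂ} {C : ℝ} (hψ : Integrable ψ) (hψb : ∀ x, ‖ψ x‖ ≤ C) {s : ℝ}
    (hs : s ∈ Ioo (0 : ℝ) (N / 2)) :
    Integrable (fun p : EuclideanSpace ℝ (Fin N) × EuclideanSpace ℝ (Fin N) =>
      (u p.2 : ℂ) * ((rieszKernel N s (p.1 - p.2) : ℂ) * ψ p.1)) (volume.prod volume) := by
  have h1 := integrable_indicator_ball_norm_rpow (N := N) hN (b := 2 * s - N) (by linarith [hs.1])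
  have i1 := (Integrable.convolution_integrand (ContinuousLinearMap.mul ℝ ℝ) hi.abs h1).const_mul
    (|kappaN N s| * C)
  have i2 := ((hψ.norm.mul_prod hi.abs).const_mul |kappaN N s|)
  have hC : 0 ≤ C := (norm_nonneg _).trans (hψb 0)
  refine (i1.add i2).mono' ?_ (Eventually.of_forall fun p => ?_)
  · have hk : Measurable fun p : EuclideanSpace ℝ (Fin N) × EuclideanSpace ℝ (Fin N) =>
        (rieszKernel N s (p.1 - p.2) : ℂ) :=
      Complex.measurable_ofReal.comp
        ((Measurable.pow_const (by fun_prop) _).const_mul (kappaN N s))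
    exact (Complex.continuous_ofReal.comp_aestronglyMeasurable hi.aestronglyMeasurable.comp_snd).mul
      (hk.aestronglyMeasurable.mul hψ.aestronglyMeasurable.comp_fst)
  · simp only [norm_mul, Complex.norm_real, Real.norm_eq_abs, Pi.add_apply,
      ContinuousLinearMap.mul_apply']
    have h2 := abs_rieszKernel_le hs (p.1 - p.2)
    set w := (Metric.ball (0 : EuclideanSpace ℝ (Fin N)) 1).indicator
        (fun z => ‖z‖ ^ (2 * s - (N : ℝ))) (p.1 - p.2) with hw
    have hw0 : 0 ≤ w := indicator_nonneg (fun z _ => by positivity) _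
    calc |u p.2| * (|rieszKernel N s (p.1 - p.2)| * ‖ψ p.1‖)
        ≤ |u p.2| * (|kappaN N s| * (w + 1) * ‖ψ p.1‖) := by gcongr
      _ = |kappaN N s| * ‖ψ p.1‖ * (|u p.2| * w) + |kappaN N s| * (‖ψ p.1‖ * |u p.2|) := by ring
      _ ≤ |kappaN N s| * C * (|u p.2| * w) + |kappaN N s| * (‖ψ p.1‖ * |u p.2|) := by
        gcongr
        exact hψb _

/-- The Fourier transform of `Φ_s ∗ u` is `|2πξ|^{-2s} 𝓕 u`. -/
lemma integral_rieszConv_mul_fourier (hN : 1 ≤ N) (hi : Integrable u)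
    {φ : EuclideanSpace ℝ (Fin N) → ℂ} {C : ℝ}
    (hb : ∀ x, ‖φ x‖ ≤ C) (hφ : Integrable φ) (hF : Integrable (𝓕 φ)) {s : ℝ}
    (hs : s ∈ Ioo (0 : ℝ) (N / 2)) :
    ∫ x, (rieszConv N s u x : ℂ) * 𝓕 φ x =
      ∫ ξ, (((2 * Real.pi * ‖ξ‖) ^ (-(2 * s)) : ℝ) : ℂ) * (φ ξ * 𝓕 (fun x => (u x : ℂ)) ξ) := by
  have h1 := integrable_rieszKernel_mul_mul hN hi hF norm_fourier_le_integral hs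
  have h2 : Integrable (fun ξ => (((2 * Real.pi * ‖ξ‖) ^ (-(2 * s)) : ℝ) : ℂ) * φ ξ) := by
    refine ((integrable_norm_rpow_mul_complex hN hb hφ (b := -(2 * s)) (by linarith [hs.2])
      (by linarith [hs.1])).const_mul (((2 * Real.pi) ^ (-(2 * s)) : ℝ) : ℂ)).congr
      (Eventually.of_forall fun ξ => ?_)
    simp only
    rw [Real.mul_rpow (by positivity) (norm_nonneg _), Complex.ofReal_mul, mul_assoc]
  have h3 : Integrable (fun p : EuclideanSpace ℝ (Fin N) × EuclideanSpace ℝ (Fin N) =>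
      (Real.fourierChar (-inner ℝ p.2 p.1) : ℂ) * ((u p.1 : ℂ) *
        ((((2 * Real.pi * ‖p.2‖) ^ (-(2 * s)) : ℝ) : ℂ) * φ p.2))) (volume.prod volume) := by
    have hm : Continuous fun p : EuclideanSpace ℝ (Fin N) × EuclideanSpace ℝ (Fin N) =>
        (Real.fourierChar (-inner ℝ p.2 p.1) : ℂ) :=
      continuous_subtype_val.comp (Real.continuous_fourierChar.comp (by fun_prop))
    refine ((Integrable.ofReal (𝕜 := ℂ) hi).mul_prod h2).bdd_mul (c := 1) hm.aestronglyMeasurable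
      (Eventually.of_forall fun ξ => ?_)
    exact (Circle.norm_coe _).le
  calc ∫ x, (rieszConv N s u x : ℂ) * 𝓕 φ x
      = ∫ x, ∫ y, (u y : ℂ) * ((rieszKernel N s (x - y) : ℂ) * 𝓕 φ x) := by
        congr 1; ext x
        rw [rieszConv_eq, ← integral_const_mul, ← integral_complex_ofReal, ← integral_mul_const]
        congr 1; ext y
        rw [rieszKernel]
        push_cast; ring
    _ = ∫ y, ∫ x, (u y : ℂ) * ((rieszKernel N s (x - y) : ℂ) * 𝓕 φ x) := integral_integral_swap h1
    _ = ∫ y, ∫ ξ, (Real.fourierChar (-inner ℝ ξ y) : ℂ) * ((u y : ℂ) *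
        ((((2 * Real.pi * ‖ξ‖) ^ (-(2 * s)) : ℝ) : ℂ) * φ ξ)) := by
        congr 1; ext y
        rw [integral_const_mul, integral_rieszKernel_sub_mul_fourier hN hb hφ hF hs y,
          ← integral_const_mul]
        congr 1; ext ξ
        rw [Circle.smul_def, smul_eq_mul]
        ring
    _ = ∫ ξ, ∫ y, (Real.fourierChar (-inner ℝ ξ y) : ℂ) * ((u y : ℂ) *
        ((((2 * Real.pi * ‖ξ‖) ^ (-(2 * s)) : ℝ) : ℂ) * φ ξ)) := integral_integral_swap h3
    _ = _ := by
        congr 1; ext ξ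
        rw [Real.fourier_eq, ← mul_assoc, ← integral_const_mul]
        congr 1; ext y
        rw [Circle.smul_def, smul_eq_mul, real_inner_comm]
        ring

/-! ### The logarithmic symbols -/

/-- `e^{ε |ln ρ|} ≤ ρ^{-ε} + ρ^ε`, and `ε < 1 ≤ N` makes the singular power locally integrable. -/
lemma locallyIntegrable_exp_abs_log (hN : 1 ≤ N) {ε : ℝ} (hε0 : 0 < ε) (hε : ε < 1) :
    LocallyIntegrable fun ξ : EuclideanSpace ℝ (Fin N) =>
      Real.exp (ε * |Real.log (2 * Real.pi * ‖ξ‖)|) := by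
  have hN' : (1 : ℝ) ≤ N := by exact_mod_cast hN
  have hpi := Real.pi_pos
  have : Nonempty (Fin N) := ⟨⟨0, hN⟩⟩
  have h1 : LocallyIntegrable fun ξ : EuclideanSpace ℝ (Fin N) =>
      (2 * Real.pi) ^ (-ε) * ‖ξ‖ ^ (-ε) :=
    locallyIntegrable_of_norm_le_rpow (C := (2 * Real.pi) ^ (-ε)) (α := ε) (by simpa using hN)
      (by simp; linarith) (Eventually.of_forall fun z => by
        rw [Real.norm_of_nonneg (by positivity)])
      ((measurable_norm.pow_const _).const_mul _).aestronglyMeasurable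
  have h2 : LocallyIntegrable fun ξ : EuclideanSpace ℝ (Fin N) => (2 * Real.pi * ‖ξ‖) ^ ε :=
    Continuous.locallyIntegrable (Continuous.rpow_const (by fun_prop) fun _ => Or.inr hε0.le)
  have hne : ∀ᵐ x : EuclideanSpace ℝ (Fin N), x ≠ 0 := by simp [ae_iff]
  refine (h1.add h2).mono ?_ ?_
  · exact (Real.measurable_exp.comp ((Real.measurable_log.comp
      (by fun_prop)).abs.const_mul ε)).aestronglyMeasurable
  · filter_upwards [hne] with ξ hξ
    have hξ' := norm_pos_iff.2 hξ
    have hρ : 0 < 2 * Real.pi * ‖ξ‖ := by positivity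
    simp only [Pi.add_apply]
    rw [Real.norm_of_nonneg (Real.exp_pos _).le, Real.norm_of_nonneg (by positivity),
      ← Real.mul_rpow (by positivity) hξ'.le]
    set ρ := 2 * Real.pi * ‖ξ‖
    rcases le_total 0 (Real.log ρ) with h | h
    · rw [abs_of_nonneg h, Real.rpow_def_of_pos hρ ε, mul_comm ε]
      have : 0 < ρ ^ (-ε) := by positivity
      linarith
    · rw [abs_of_nonpos h, Real.rpow_def_of_pos hρ (-ε), mul_neg, mul_neg, mul_comm ε]
      have : 0 < ρ ^ ε := by positivity
      linarith

lemma measurable_log_norm_pow (m : ℕ) : Measurable fun ξ : EuclideanSpace ℝ (Fin N) =>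
    (2 * Real.log (2 * Real.pi * ‖ξ‖)) ^ m :=
  ((Real.measurable_log.comp (by fun_prop)).const_mul 2).pow_const m

/-- The `k`-th derivative of `s ↦ ρ^{-2s}`, written so that `logPower` estimates apply. -/
noncomputable def symbolDeriv (N k : ℕ) (s ρ : ℝ) : ℝ :=
  (-1) ^ k * logPower N k (-s) ρ * ρ ^ N

lemma symbolDeriv_eq {k : ℕ} {s ρ : ℝ} (hρ : 0 < ρ) :
    symbolDeriv N k s ρ = ρ ^ (-(2 * s)) * (-(2 * Real.log ρ)) ^ k := by
  have : ρ ^ (2 * -s - (N : ℝ)) * ρ ^ N = ρ ^ (-(2 * s)) := by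
    rw [← Real.rpow_natCast ρ N, ← Real.rpow_add hρ]; congr 1; ring
  rw [symbolDeriv, logPower, neg_eq_neg_one_mul (2 * Real.log ρ), mul_pow (-1 : ℝ), ← this]
  ring

lemma hasDerivAt_symbolDeriv (k : ℕ) (s : ℝ) {ρ : ℝ} (hρ : 0 < ρ) :
    HasDerivAt (fun t => symbolDeriv N k t ρ) (symbolDeriv N (k + 1) s ρ) s := by
  have h1 := (hasDerivAt_logPower N k (-s) hρ).comp s (hasDerivAt_neg s)
  refine ((h1.const_mul ((-1) ^ k)).mul_const (ρ ^ N)).congr_deriv ?_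
  rw [symbolDeriv, pow_succ]
  ring

lemma abs_symbolDeriv_le (hN : 1 ≤ N) {ε : ℝ} (hε : 0 < ε) (hε1 : ε ≤ 1) (k : ℕ) {s ρ : ℝ}
    (hs : |s| ≤ ε / 4) (hρ : 0 < ρ) :
    |symbolDeriv N k s ρ| ≤ (k.factorial * (4 / ε) ^ k) * Real.exp (ε * |Real.log ρ|) := by
  have h := abs_logPower_le hN hε hε1 k (s := -s) (by rwa [abs_neg]) hρ.le
  have e : ρ ^ (-(N : ℝ)) * ρ ^ N = 1 := by
    rw [← Real.rpow_natCast ρ N, ← Real.rpow_add hρ]; simp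
  rw [symbolDeriv, abs_mul, abs_mul, abs_pow, abs_neg, abs_one, one_pow, one_mul,
    abs_of_pos (by positivity : 0 < ρ ^ N)]
  calc |logPower N k (-s) ρ| * ρ ^ N
      ≤ (k.factorial * (4 / ε) ^ k) * logWeight N ε ρ * ρ ^ N := by gcongr
    _ = (k.factorial * (4 / ε) ^ k) * Real.exp (ε * |Real.log ρ|) * (ρ ^ (-(N : ℝ)) * ρ ^ N) := by
      rw [logWeight]; ring
    _ = _ := by rw [e, mul_one]

lemma measurable_symbolDeriv (k : ℕ) (s : ℝ) : Measurable fun ξ : EuclideanSpace ℝ (Fin N) =>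
    symbolDeriv N k s (2 * Real.pi * ‖ξ‖) :=
  (((measurable_logPower N k (-s)).comp (by fun_prop)).const_mul _).mul (by fun_prop)

/-- The dominating weight is only locally integrable, so the compact support of `ψ` supplies
integrability. -/
lemma hasDerivAt_integral_symbolDeriv (hN : 1 ≤ N) {ε : ℝ} (hε : 0 < ε) (hε1 : ε < 1)
    {ψ : EuclideanSpace ℝ (Fin N) → ℂ} (hψ : Continuous ψ) (hψc : HasCompactSupport ψ) (k : ℕ)
    {s : ℝ} (hs : s ∈ Ioo (-(ε / 4)) (ε / 4)) :
    HasDerivAt (fun t => ∫ ξ, (symbolDeriv N k t (2 * Real.pi * ‖ξ‖) : ℂ) * ψ ξ)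
      (∫ ξ, (symbolDeriv N (k + 1) s (2 * Real.pi * ‖ξ‖) : ℂ) * ψ ξ) s := by
  have hpi := Real.pi_pos
  have : Nonempty (Fin N) := ⟨⟨0, hN⟩⟩
  have hne : ∀ᵐ x : EuclideanSpace ℝ (Fin N), x ≠ 0 := by simp [ae_iff]
  have hI : Integrable fun ξ => ‖ψ ξ‖ * Real.exp (ε * |Real.log (2 * Real.pi * ‖ξ‖)|) :=
    (locallyIntegrable_exp_abs_log hN hε hε1).integrable_smul_left_of_hasCompactSupport hψ.norm
      hψc.norm
  have hm (k : ℕ) (s : ℝ) : AEStronglyMeasurable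
      (fun ξ => (symbolDeriv N k s (2 * Real.pi * ‖ξ‖) : ℂ) * ψ ξ) volume :=
    (Complex.measurable_ofReal.comp (measurable_symbolDeriv k s)).aestronglyMeasurable.mul
      hψ.aestronglyMeasurable
  have hbound (k : ℕ) : ∀ᵐ ξ : EuclideanSpace ℝ (Fin N), ∀ t ∈ Ioo (-(ε / 4)) (ε / 4),
      ‖(symbolDeriv N k t (2 * Real.pi * ‖ξ‖) : ℂ) * ψ ξ‖ ≤ (k.factorial * (4 / ε) ^ k) *
        (‖ψ ξ‖ * Real.exp (ε * |Real.log (2 * Real.pi * ‖ξ‖)|)) := by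
    filter_upwards [hne] with ξ hξ t ht
    have hξ' := norm_pos_iff.2 hξ
    rw [norm_mul, Complex.norm_real, Real.norm_eq_abs]
    have h := abs_symbolDeriv_le hN hε hε1.le k (abs_le.2 ⟨ht.1.le, ht.2.le⟩)
      (show 0 < 2 * Real.pi * ‖ξ‖ by positivity)
    calc _ ≤ _ := mul_le_mul_of_nonneg_right h (norm_nonneg (ψ ξ))
      _ = _ := by ring
  refine (hasDerivAt_integral_of_dominated_loc_of_deriv_le (isOpen_Ioo.mem_nhds hs)
    (Eventually.of_forall (hm k)) ((hI.const_mul (k.factorial * (4 / ε) ^ k)).mono' (hm k s) ?_)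
    (hm (k + 1) s) (hbound (k + 1)) (hI.const_mul _) ?_).2
  · filter_upwards [hbound k] with ξ h using h s hs
  · filter_upwards [hne] with ξ hξ t _
    have hξ' := norm_pos_iff.2 hξ
    exact ((hasDerivAt_symbolDeriv k t (by positivity)).ofReal_comp).mul_const _

lemma hasDerivAt_integral_iteratedDeriv_rieszExt (hN : 1 ≤ N) {ε : ℝ} (hu : Admissible ε u)
    {B₁ B₂ : ℝ} (hb : ∀ x, |u x| ≤ B₁) (hM : ∀ x, majorant ε u x ≤ B₂)
    {ψ : EuclideanSpace ℝ (Fin N) → ℂ} (hψ : Integrable ψ) (k : ℕ) {s : ℝ}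
    (hs : s ∈ Ioo (-(ε / 8)) (ε / 8)) :
    HasDerivAt (fun t => ∫ x, ((iteratedDeriv k (rieszExt u x) t : ℝ) : ℂ) * ψ x)
      (∫ x, ((iteratedDeriv (k + 1) (rieszExt u x) s : ℝ) : ℂ) * ψ x) s := by
  have hε := hu.pos
  have hsub : Ioo (-(ε / 8)) (ε / 8) ⊆ Ioo (-(ε / 4)) (ε / 4) :=
    Ioo_subset_Ioo (by linarith) (by linarith)
  have hm (k : ℕ) {s : ℝ} (hs : s ∈ Ioo (-(ε / 8)) (ε / 8)) : AEStronglyMeasurable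
      (fun x => ((iteratedDeriv k (rieszExt u x) s : ℝ) : ℂ) * ψ x) volume :=
    (Complex.measurable_ofReal.comp
      (measurable_iteratedDeriv_rieszExt hN hu k (hsub hs))).aestronglyMeasurable.mul
      hψ.aestronglyMeasurable
  choose C hC0 hC using exists_abs_iteratedDeriv_rieszExt_le hN hu
  have hbound (k : ℕ) (x : EuclideanSpace ℝ (Fin N)) (t : ℝ) (ht : t ∈ Ioo (-(ε / 8)) (ε / 8)) :
      ‖((iteratedDeriv k (rieszExt u x) t : ℝ) : ℂ) * ψ x‖ ≤ C k * (B₁ + B₂) * ‖ψ x‖ := by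
    rw [norm_mul, Complex.norm_real, Real.norm_eq_abs]
    gcongr
    refine (hC k t ⟨ht.1.le, ht.2.le⟩ x).trans ?_
    have := hC0 k
    gcongr
    · exact hb x
    · exact hM x
  refine (hasDerivAt_integral_of_dominated_loc_of_deriv_le (isOpen_Ioo.mem_nhds hs)
    (by filter_upwards [isOpen_Ioo.mem_nhds hs] with t ht using hm k ht)
    ((hψ.norm.const_mul (C k * (B₁ + B₂))).mono' (hm k hs)
      (Eventually.of_forall fun x => hbound k x s hs))
    (hm (k + 1) hs) (Eventually.of_forall (hbound (k + 1))) (hψ.norm.const_mul _) ?_).2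
  filter_upwards with x t ht
  exact ((hasDerivAt_iteratedDeriv isOpen_Ioo (contDiffOn_rieszExt hN hu x) k
    (hsub ht)).ofReal_comp).mul_const _

/-- The weak form of the Fourier symbol of the logarithmic Laplacian. -/
lemma integral_logLap_mul_fourier (hN : 1 ≤ N) {ε : ℝ} (hu : Admissible ε u) (hε1 : ε < 1)
    {B₁ B₂ : ℝ} (hb : ∀ x, |u x| ≤ B₁) (hM : ∀ x, majorant ε u x ≤ B₂) (hi : Integrable u)
    {m : ℕ} (hm : 1 ≤ m) {φ : EuclideanSpace ℝ (Fin N) → ℂ} (hφ : Continuous φ)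
    (hφc : HasCompactSupport φ) (hF : Integrable (𝓕 φ)) :
    ∫ x, (logLap N m u x : ℂ) * 𝓕 φ x =
      ∫ ξ, (((2 * Real.log (2 * Real.pi * ‖ξ‖)) ^ m : ℝ) : ℂ) *
        (φ ξ * 𝓕 (fun x => (u x : ℂ)) ξ) := by
  have hpi := Real.pi_pos
  have hε := hu.pos
  have hN' : (1 : ℝ) ≤ N := by exact_mod_cast hN
  have : Nonempty (Fin N) := ⟨⟨0, hN⟩⟩
  have hne : ∀ᵐ x : EuclideanSpace ℝ (Fin N), x ≠ 0 := by simp [ae_iff]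
  obtain ⟨C, hC⟩ := hφ.bounded_above_of_compact_support hφc
  have hFu : Continuous (𝓕 (fun x => (u x : ℂ))) :=
    VectorFourier.fourierIntegral_continuous Real.continuous_fourierChar continuous_inner
      (Integrable.ofReal (𝕜 := ℂ) hi)
  set ψ : EuclideanSpace ℝ (Fin N) → ℂ := fun ξ => φ ξ * 𝓕 (fun x => (u x : ℂ)) ξ with hψ
  have hψc : Continuous ψ := hφ.mul hFu
  have hψs : HasCompactSupport ψ := hφc.mul_right
  -- The transform identity is available only for `s > 0`, but both sides are smooth across `0`.
  have key := eq_of_hasDerivAt_succ_of_eqOn (δ := ε / 8) (by positivity)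
    (f := fun k t => ∫ x, ((iteratedDeriv k (rieszExt u x) t : ℝ) : ℂ) * 𝓕 φ x)
    (g := fun k t => ∫ ξ, (symbolDeriv N k t (2 * Real.pi * ‖ξ‖) : ℂ) * ψ ξ)
    (fun k s hs => hasDerivAt_integral_iteratedDeriv_rieszExt hN hu hb hM hF k hs)
    (fun k s hs => hasDerivAt_integral_symbolDeriv hN hε hε1 hψc hψs k
      ⟨by linarith [hs.1], by linarith [hs.2]⟩)
    (fun s hs => by
      have hs' : s ∈ Ioo (0 : ℝ) (N / 2) := ⟨hs.1, by linarith [hs.2]⟩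
      have h := integral_rieszConv_mul_fourier hN hi hC (hφ.integrable_of_hasCompactSupport hφc)
        hF hs'
      simp only [iteratedDeriv_zero]
      simp_rw [rieszConv_eq_rieszExt hN hb hi hs'] at h
      rw [h]
      refine integral_congr_ae ?_
      filter_upwards [hne] with ξ hξ
      have hξ' := norm_pos_iff.2 hξ
      rw [symbolDeriv_eq (by positivity), pow_zero, mul_one]) m
  have e1 : ∫ x, (logLap N m u x : ℂ) * 𝓕 φ x =
      (-1) ^ m * ∫ x, ((iteratedDeriv m (rieszExt u x) 0 : ℝ) : ℂ) * 𝓕 φ x := by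
    rw [← integral_const_mul]
    congr 1; ext x
    rw [logLap_eq_iteratedDeriv hN hu hm]
    push_cast; ring
  rw [e1]
  rw [key, ← integral_const_mul]
  refine integral_congr_ae ?_
  filter_upwards [hne] with ξ hξ
  have hξ' := norm_pos_iff.2 hξ
  rw [symbolDeriv_eq (by positivity), ← mul_assoc]
  congr 1
  have : ((-1 : ℝ)) ^ m * (-(2 * Real.log (2 * Real.pi * ‖ξ‖))) ^ m =
      (2 * Real.log (2 * Real.pi * ‖ξ‖)) ^ m := by
    rw [← mul_pow]; ring
  rw [← this]
  simp

end LogLap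

namespace LogLap

variable {N : ℕ} {u : EuclideanSpace ℝ (Fin N) → ℝ}

/-! ### The Fourier symbol -/

lemma fourierL1_eq (f : EuclideanSpace ℝ (Fin N) → ℂ) (ζ : EuclideanSpace ℝ (Fin N)) :
    fourierL1 f ζ = 𝓕 f ((2 * Real.pi)⁻¹ • ζ) := by
  rw [fourierL1, Real.fourier_eq']
  congr 1; ext x
  rw [smul_eq_mul, inner_smul_right]
  congr 2
  have : (Real.pi : ℂ) ≠ 0 := by exact_mod_cast Real.pi_ne_zero
  push_cast
  field_simp

/-- The `L²` transform agrees with that of tempered distributions, which is defined by moving `𝓕`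
onto the Schwartz function. -/
lemma integral_smul_fourier_toLp {f : EuclideanSpace ℝ (Fin N) → ℂ} (hf : MemLp f 2)
    (φ : SchwartzMap (EuclideanSpace ℝ (Fin N)) ℂ) :
    ∫ ξ, φ ξ • (𝓕 (hf.toLp f) : Lp ℂ 2 (volume : Measure (EuclideanSpace ℝ (Fin N)))) ξ =
      ∫ x, f x * 𝓕 (φ : EuclideanSpace ℝ (Fin N) → ℂ) x := by
  rw [← Lp.toTemperedDistribution_apply, ← Lp.fourier_toTemperedDistribution_eq,
    TemperedDistribution.fourier_apply, Lp.toTemperedDistribution_apply]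
  refine integral_congr_ae ?_
  filter_upwards [hf.coeFn_toLp] with x hx
  rw [hx, smul_eq_mul, mul_comm, SchwartzMap.fourier_coe]

/-- Both sides are locally integrable and have the same integrals against smooth compactly supported
functions. -/
lemma fourier_toLp_logLap (hN : 1 ≤ N) {ε : ℝ} (hu : Admissible ε u) (hε1 : ε < 1)
    {B₁ B₂ : ℝ} (hb : ∀ x, |u x| ≤ B₁) (hM : ∀ x, majorant ε u x ≤ B₂) (hi : Integrable u)
    {m : ℕ} (hm : 1 ≤ m) (h : MemLp (fun x => (logLap N m u x : ℂ)) 2 volume) :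
    ∀ᵐ ξ, (𝓕 (h.toLp _) : Lp ℂ 2 (volume : Measure (EuclideanSpace ℝ (Fin N)))) ξ =
      (((2 * Real.log (2 * Real.pi * ‖ξ‖)) ^ m : ℝ) : ℂ) * 𝓕 (fun x => (u x : ℂ)) ξ := by
  have hpi := Real.pi_pos
  have hε := hu.pos
  have : Nonempty (Fin N) := ⟨⟨0, hN⟩⟩
  have hne : ∀ᵐ x : EuclideanSpace ℝ (Fin N), x ≠ 0 := by simp [ae_iff]
  have hFu : Continuous (𝓕 (fun x => (u x : ℂ))) :=
    VectorFourier.fourierIntegral_continuous Real.continuous_fourierChar continuous_inner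
      (Integrable.ofReal (𝕜 := ℂ) hi)
  have hloc : LocallyIntegrable fun ξ : EuclideanSpace ℝ (Fin N) =>
      (((2 * Real.log (2 * Real.pi * ‖ξ‖)) ^ m : ℝ) : ℂ) * 𝓕 (fun x => (u x : ℂ)) ξ := by
    set K := (m.factorial * (4 / ε) ^ m) * ∫ v, ‖(u v : ℂ)‖ with hK
    have hK0 : 0 ≤ K := by positivity
    refine ((locallyIntegrable_exp_abs_log hN hε hε1).smul K).mono
      ((Complex.measurable_ofReal.comp (measurable_log_norm_pow m)).aestronglyMeasurable.mul
        hFu.aestronglyMeasurable) ?_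
    filter_upwards [hne] with ξ hξ
    have hξ' := norm_pos_iff.2 hξ
    -- At `s = 0` the bound for the differentiated symbol is a bound for `|2 ln ρ|^m`.
    have h1 := abs_symbolDeriv_le hN hε hε1.le m (s := 0) (by simp; positivity)
      (show 0 < 2 * Real.pi * ‖ξ‖ by positivity)
    rw [symbolDeriv_eq (by positivity)] at h1
    simp only [mul_zero, neg_zero, Real.rpow_zero, one_mul, abs_pow, abs_neg] at h1
    simp only [Pi.smul_apply, smul_eq_mul, norm_mul, Complex.norm_real, norm_pow]
    rw [← norm_mul, Real.norm_eq_abs, Real.norm_of_nonneg hK0,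
      Real.norm_of_nonneg (Real.exp_pos _).le]
    calc _ ≤ (m.factorial * (4 / ε) ^ m) * Real.exp (ε * |Real.log (2 * Real.pi * ‖ξ‖)|) *
          ∫ v, ‖(u v : ℂ)‖ := by
          gcongr
          exact norm_fourier_le_integral ξ
      _ = _ := by rw [hK]; ring
  refine ae_eq_of_integral_contDiff_smul_eq ((Lp.memLp _).locallyIntegrable (by norm_num)) hloc
    fun g hg hgc => ?_
  have hgc' : HasCompactSupport (Complex.ofRealCLM ∘ g) := hgc.comp_left rfl
  have hg' : ContDiff ℝ (⊤ : ℕ∞) (Complex.ofRealCLM ∘ g) := by fun_prop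
  set φ := hgc'.toSchwartzMap hg' with hφ
  have h1 := integral_smul_fourier_toLp h φ
  have hFi : Integrable (𝓕 (φ : EuclideanSpace ℝ (Fin N) → ℂ)) := by
    rw [← SchwartzMap.fourier_coe]
    exact (𝓕 φ).integrable
  have h2 := integral_logLap_mul_fourier hN hu hε1 hb hM hi hm (φ := φ) φ.continuous hgc' hFi
  rw [h2] at h1
  have hφg (ξ) : φ ξ = (g ξ : ℂ) := rfl
  simp only [hφg, smul_eq_mul] at h1
  simp only [Complex.real_smul]
  rw [h1]
  congr 1; ext ξ
  ring

lemma fourierL2_logLap (hN : 1 ≤ N) {ε : ℝ} (hu : Admissible ε u) (hε1 : ε < 1)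
    {B₁ B₂ : ℝ} (hb : ∀ x, |u x| ≤ B₁) (hM : ∀ x, majorant ε u x ≤ B₂) (hi : Integrable u)
    {m : ℕ} (hm : 1 ≤ m) (h : MemLp (fun x => (logLap N m u x : ℂ)) 2 volume) :
    ∀ᵐ ζ : EuclideanSpace ℝ (Fin N), fourierL2 h ζ =
      (((2 * Real.log ‖ζ‖) ^ m : ℝ) : ℂ) * fourierL1 (fun x => (u x : ℂ)) ζ := by
  have hpi := Real.pi_pos
  -- The exceptional null set must be pulled back under `ζ ↦ ζ/(2π)`.
  have hq := Measure.quasiMeasurePreserving_smul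
    (volume : Measure (EuclideanSpace ℝ (Fin N))) (r := (2 * Real.pi)⁻¹) (by positivity)
  filter_upwards [hq.ae (fourier_toLp_logLap hN hu hε1 hb hM hi hm h)] with ζ hζ
  rw [fourierL2, hζ, fourierL1_eq, norm_smul, Real.norm_of_nonneg (by positivity),
    mul_inv_cancel_left₀ (by positivity)]

/-! ### Hölder continuous functions with compact support -/

lemma HolderCompact.ulocHolder {α : ℝ≥0} (hα : 0 < α) (hu : HolderCompact α u) :
    UlocHolder α u := by
  obtain ⟨hs, C, hC⟩ := hu
  obtain ⟨B, hB⟩ := (hC.continuous hα).bounded_above_of_compact_support hs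
  refine ⟨max C B.toNNReal, fun x => ⟨fun y _ => ?_, fun y _ z _ => ?_⟩⟩
  · refine (hB y).trans ((Real.le_coe_toNNReal B).trans ?_)
    exact_mod_cast le_max_right _ _
  · refine (hC y z).trans ?_
    gcongr
    exact le_max_left _ _

end LogLap

/-! ### Assembly: choice of `ε` in the two regimes -/

theorem theorem1p1 (N : ℕ) (hN : 1 ≤ N) (m : ℕ) (hm : 1 ≤ m)
    (α : ℝ≥0) (hα0 : 0 < α) (hα1 : α < 1) :
    (∀ u : EuclideanSpace ℝ (Fin N) → ℝ,
      LogLap.UlocHolder α u → MemLp u ∞ volume → MemLp u 1 volume →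
        -- the integrals that define `L_m u` and `Φ_s ∗ u` converge absolutely at every point
        (∀ x, (∀ j, 1 ≤ j → Integrable (LogLap.logIntegrand N j u x) volume) ∧
          ∀ s ∈ Ioo (0 : ℝ) ((N : ℝ) / 2),
            ConvolutionExistsAt (LogLap.rieszKernel N s) u x
              (ContinuousLinearMap.mul ℝ ℝ) volume) ∧
        -- the `m`-th right derivative at `s = 0` of the Riesz potential
        (∀ x, ContDiffWithinAt ℝ m (LogLap.rieszFamily N u x) (Ico (0 : ℝ) ((N : ℝ) / 2)) 0 ∧
          iteratedDerivWithin m (LogLap.rieszFamily N u x) (Ico (0 : ℝ) ((N : ℝ) / 2)) 0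
            = (-1) ^ m * LogLap.logLap N m u x) ∧
        -- the Fourier symbol
        (∃ h : MemLp (fun x => (LogLap.logLap N m u x : ℂ)) 2 volume,
          ∀ᵐ ζ : EuclideanSpace ℝ (Fin N),
            LogLap.fourierL2 h ζ
              = (((2 * Real.log ‖ζ‖) ^ m : ℝ) : ℂ) * LogLap.fourierL1 (fun x => (u x : ℂ)) ζ)) ∧
    -- the expansion in `L^p`
    (∀ u : EuclideanSpace ℝ (Fin N) → ℝ, LogLap.HolderCompact α u → ∀ p : ℝ≥0∞, 1 < p →
      MemLp (LogLap.logLap N m u) p volume ∧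
      (∀ᶠ s in 𝓝[>] (0 : ℝ), MemLp (LogLap.taylorQuotient N m u s) p volume) ∧
      Tendsto (fun s : ℝ => eLpNorm
          (fun x => LogLap.taylorQuotient N m u s x - (-1) ^ m * LogLap.logLap N m u x) p volume)
        (𝓝[>] (0 : ℝ)) (𝓝 0)) := by
  have hN' : (1 : ℝ) ≤ N := by exact_mod_cast hN
  have hα0' : (0 : ℝ) < α := by exact_mod_cast hα0
  have hα1' : (α : ℝ) < 1 := by exact_mod_cast hα1
  refine ⟨fun u hu _ hu1 => ?_, fun u hu p hp => ?_⟩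
  · obtain ⟨C, hC0, hb, hC⟩ := hu.exists_bound
    have hc := hu.continuous hα0
    have hi : Integrable u := memLp_one_iff_integrable.1 hu1
    -- `ε = α/4` is below `α/2` and `1/2`, as the `L²` bound on the majorant requires.
    have had : LogLap.Admissible (α / 4) u :=
      LogLap.admissible_of_holder hN (by positivity) (by linarith) (by linarith) hc hC hi
    obtain ⟨B, -, hB⟩ := LogLap.exists_majorant_le hN had.pos had.le_one
      (by linarith : (α / 4 : ℝ) < α) hc hC hi
    have hM2 := LogLap.memLp_two_majorant hN had (by linarith) (by linarith) hC0 hC hi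
    have hu2 : MemLp u 2 := by
      rw [memLp_two_iff_integrable_sq hu1.1]
      simp_rw [sq]
      exact hi.bdd_mul hu1.1 (Eventually.of_forall hb)
    have hL : MemLp (fun x => (LogLap.logLap N m u x : ℂ)) 2 volume :=
      (LogLap.memLp_logLap hN had hm hu2 hM2).ofReal
    exact ⟨fun x => ⟨fun j _ => LogLap.integrable_logIntegrand hN had x,
        fun s hs => LogLap.convolutionExistsAt_rieszKernel hN hb hi hs x⟩,
      fun x => LogLap.contDiffWithinAt_rieszFamily hN had hb hi x hm,
      hL, LogLap.fourierL2_logLap hN had (by linarith) hb hB hi hm hL⟩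
  · obtain ⟨C, hC0, hb, hC⟩ := (hu.ulocHolder hα0).exists_bound
    have hc := (hu.ulocHolder hα0).continuous hα0
    have hi : Integrable u := hc.integrable_of_hasCompactSupport hu.1
    obtain ⟨ε, hε0, hεα, hεp⟩ : ∃ ε : ℝ, 0 < ε ∧ ε < α ∧
        (p = ∞ ∨ (N : ℝ) < (N - ε) * p.toReal) := by
      rcases eq_or_ne p ∞ with h | h
      · exact ⟨α / 2, by positivity, by linarith, Or.inl h⟩
      · have hp1 : 1 < p.toReal := by
          rw [← ENNReal.toReal_one]
          exact (ENNReal.toReal_lt_toReal ENNReal.one_ne_top h).2 hp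
        -- `(N - ε) p > N` means `ε < N - N/p`, which is positive because `p > 1`; half of it is
        -- taken.
        refine ⟨min (α / 2) ((N - N / p.toReal) / 2), ?_, ?_, Or.inr ?_⟩
        · have : N / p.toReal < (N : ℝ) := div_lt_self (by linarith) hp1
          exact lt_min (by positivity) (by linarith)
        · exact (min_le_left _ _).trans_lt (by linarith)
        · have h1 := min_le_right ((α : ℝ) / 2) ((N - N / p.toReal) / 2)
          have h2 : N / p.toReal < (N : ℝ) := div_lt_self (by linarith) hp1
          rw [← div_lt_iff₀ (by linarith)]
          linarith
    have had : LogLap.Admissible ε u :=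
      LogLap.admissible_of_holder hN hε0 (by linarith) hεα hc hC hi
    obtain ⟨B, -, hB⟩ := LogLap.exists_majorant_le hN had.pos had.le_one hεα hc hC hi
    have hMp := LogLap.memLp_majorant_of_hasCompactSupport hN had hu.1 hB
      (zero_lt_one.trans hp).ne' hεp
    have hup : MemLp u p := hc.memLp_of_hasCompactSupport hu.1
    exact ⟨LogLap.memLp_logLap hN had hm hup hMp,
      LogLap.taylorQuotient_expansion hN had hb hi hm hup hMp⟩
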